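/- Let $d,N\in\mathbb N$, $1<p<\infty$, let $\lambda_1,\dots,\lambda_N>0$ with $\sum_{i=1}^N\lambda_i=1$, and let $\mu_1,\dots,\mu_N$ be Borel probability measures on $\mathbb R^d$. For $\mathbf x=(x_1,\dots,x_N)\in\mathbb R^{Nd}$ let $$\overline x_p(\mathbf x)=\operatorname*{arg\,min}_{z\in\mathbb R^d}\sum_{i=1}^N\lambda_i|x_i-z|^p$$ (the minimizer exists and is unique) and $$c_p(\mathbf x)=\min_{z\in\mathbb R^d}\sum_{i=1}^N\lambda_i|x_i-z|^p .$$ Let $\Pi(\mu_1,\dots,\mu_N)$ be the set of Borel probability measures on $\mathbb R^{Nd}$ whose $i$-th marginal is $\mu_i$ for every $i$. A set $\Gamma\subset\mathbb R^{Nd}$ is called $c_p$-monotone if for all $\mathbf x^1,\mathbf x^2\in\Gamma$ and all permutations $\sigma_1,\dots,\sigma_N$ of $\{1,2\}$, $$c_p(\mathbf x^1)+c_p(\mathbf x^2)\le c_p\big(x_1^{\sigma_1(1)},\dots,x_N^{\sigma_N(1)}\big)+c_p\big(x_1^{\sigma_1(2)},\dots,x_N^{\sigma_N(2)}\big).$$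 Assume that either $\mu_i\ll\mathcal L^d$ for every $i=1,\dots,N$, or that $p\ge 2$ and $\mu_i\ll\mathcal L^d$ for at least one $i$. Then: 1. The map $\overline x_p$ is Borel measurable, and for every $\gamma_p\in\Pi(\mu_1,\dots,\mu_N)$ whose support is $c_p$-monotone, the pushforward satisfies $(\overline x_p)_\sharp\gamma_p\ll\mathcal L^d$. 2. If in addition $\int_{\mathbb R^d}|x|^p\,\mathrm d\mu_i<\infty$ for every $i$, then every $p$-Wasserstein barycenter of $\mu_1,\dots,\mu_N$ with weights $\lambda_1,\dots,\lambda_N$ is absolutely continuous with respect to $\mathcal L^d$. Here a $p$-Wasserstein barycenter is a minimizer $\nu$ of $\sum_{i=1}^N\lambda_iW_p^p(\mu_i,\nu)$ over the set $\mathcal P_p(\mathbb R^d)$ of Borel probability measures on $\mathbb R^d$ with finite $p$-th moment, where $W_p(\mu,\rho)$ is the infimum of $\big(\int|x-y|^p\,\mathrm d\eta(x,y)\big)^{1/p}$ over all Borel probability measures $\eta$ on $\mathbb R^{2d}$ with marginals $\mu$ and $\rho$. -/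

import Mathlib

open MeasureTheory
open scoped ENNReal

/-- The function `z ↦ ∑ i, λ i * |x i - z| ^ p` whose minimization defines the `p`-barycenter of
the points `x 0, …, x (N - 1)` with weights `λ`. -/
noncomputable def weightedPowSum {d N : ℕ} (p : ℝ) (lam : Fin N → ℝ)
    (x : Fin N → EuclideanSpace ℝ (Fin d)) (z : EuclideanSpace ℝ (Fin d)) : ℝ :=
  ∑ i, lam i * ‖x i - z‖ ^ p

/-- For `1 < p` and positive weights, the minimizer of `weightedPowSum` exists and is unique, so
that the arg min below is well defined. -/
theorem existsUnique_isMinOn_weightedPowSum {d N : ℕ} {p : ℝ} (hp : 1 < p) {lam : Fin N → ℝ}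
    (hlam : ∀ i, 0 < lam i) (hsum : ∑ i, lam i = 1) (x : Fin N → EuclideanSpace ℝ (Fin d)) :
    ∃! z, IsMinOn (weightedPowSum p lam x) Set.univ z := by
  have hp0 : 0 < p := by linarith
  have hN : Nonempty (Fin N) := by
    by_contra h
    rw [not_nonempty_iff] at h
    simp at hsum
  have hcont : Continuous (weightedPowSum p lam x) := by
    unfold weightedPowSum
    refine continuous_finsetSum _ fun i _ => continuous_const.mul ?_
    exact (continuous_const.sub continuous_id).norm.rpow_const fun _ => Or.inr hp0.le
  obtain ⟨i₀⟩ := hN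
  have hcoer : Filter.Tendsto (weightedPowSum p lam x)
      (Filter.cocompact (EuclideanSpace ℝ (Fin d))) Filter.atTop := by
    have h1 : Filter.Tendsto (fun z => ‖x i₀ - z‖)
        (Filter.cocompact (EuclideanSpace ℝ (Fin d))) Filter.atTop := by
      have h2 : Filter.Tendsto (fun z : EuclideanSpace ℝ (Fin d) => ‖z‖ - ‖x i₀‖)
          (Filter.cocompact (EuclideanSpace ℝ (Fin d))) Filter.atTop :=
        Filter.tendsto_atTop_add_const_right _ _ tendsto_norm_cocompact_atTop
      refine Filter.tendsto_atTop_mono (fun z => ?_) h2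
      rw [norm_sub_rev]
      exact norm_sub_norm_le _ _
    have h3 := ((tendsto_rpow_atTop hp0).comp h1).const_mul_atTop (hlam i₀)
    refine Filter.tendsto_atTop_mono (fun z => ?_) h3
    exact Finset.single_le_sum (f := fun i => lam i * ‖x i - z‖ ^ p)
      (fun i _ => mul_nonneg (hlam i).le (Real.rpow_nonneg (norm_nonneg _) _))
      (Finset.mem_univ i₀)
  obtain ⟨z, hz⟩ := hcont.exists_forall_le hcoer
  refine ⟨z, fun y _ => hz y, fun y hy => ?_⟩
  by_contra hne
  have hyz : weightedPowSum p lam x y = weightedPowSum p lam x z :=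
    le_antisymm (hy (Set.mem_univ z)) (hz y)
  have key : ∀ i, ‖x i - ((1 / 2 : ℝ) • y + (1 / 2 : ℝ) • z)‖ ^ p
      < (1 / 2) * ‖x i - y‖ ^ p + (1 / 2) * ‖x i - z‖ ^ p := by
    intro i
    have hmid : x i - ((1 / 2 : ℝ) • y + (1 / 2 : ℝ) • z)
        = (1 / 2 : ℝ) • (x i - y) + (1 / 2 : ℝ) • (x i - z) := by module
    rw [hmid]
    by_cases hn : ‖x i - y‖ = ‖x i - z‖
    · have hne' : x i - y ≠ x i - z := fun h => hne (sub_right_injective h)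
      have := norm_combo_lt_of_ne (le_refl ‖x i - y‖) hn.ge hne'
        (by norm_num : (0 : ℝ) < 1 / 2) (by norm_num : (0 : ℝ) < 1 / 2) (by norm_num)
      have := Real.rpow_lt_rpow (norm_nonneg _) this hp0
      rw [← hn]
      linarith
    · have hle : ‖(1 / 2 : ℝ) • (x i - y) + (1 / 2 : ℝ) • (x i - z)‖
          ≤ (1 / 2) * ‖x i - y‖ + (1 / 2) * ‖x i - z‖ := by
        refine (norm_add_le _ _).trans (le_of_eq ?_)
        simp [norm_smul]
      refine (Real.rpow_le_rpow (norm_nonneg _) hle hp0.le).trans_lt ?_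
      have := (strictConvexOn_rpow hp).2 (Set.mem_Ici.2 (norm_nonneg (x i - y)))
        (Set.mem_Ici.2 (norm_nonneg (x i - z))) hn (by norm_num : (0 : ℝ) < 1 / 2)
        (by norm_num : (0 : ℝ) < 1 / 2) (by norm_num)
      simpa [smul_eq_mul] using this
  have hlt : weightedPowSum p lam x ((1 / 2 : ℝ) • y + (1 / 2 : ℝ) • z)
      < (1 / 2) * weightedPowSum p lam x y + (1 / 2) * weightedPowSum p lam x z := by
    unfold weightedPowSum
    rw [Finset.mul_sum, Finset.mul_sum, ← Finset.sum_add_distrib]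
    refine Finset.sum_lt_sum_of_nonempty ⟨i₀, Finset.mem_univ _⟩ fun i _ => ?_
    have := mul_lt_mul_of_pos_left (key i) (hlam i)
    linarith
  have := hz ((1 / 2 : ℝ) • y + (1 / 2 : ℝ) • z)
  linarith

/-- The classical `p`-barycenter of points: the arg min over `z` of `∑ i, λ i * |x i - z| ^ p`. -/
noncomputable def pBarycenter {d N : ℕ} (p : ℝ) (lam : Fin N → ℝ)
    (x : Fin N → EuclideanSpace ℝ (Fin d)) : EuclideanSpace ℝ (Fin d) :=
  Classical.epsilon fun z => IsMinOn (weightedPowSum p lam x) Set.univ z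

/-- The multi-marginal cost `c_p(x) = min_z ∑ i, λ i * |x i - z| ^ p`, i.e. the value at the
`p`-barycenter. -/
noncomputable def pCost {d N : ℕ} (p : ℝ) (lam : Fin N → ℝ)
    (x : Fin N → EuclideanSpace ℝ (Fin d)) : ℝ :=
  weightedPowSum p lam x (pBarycenter p lam x)

/-- The arg min defining `pBarycenter` is attained. -/
theorem isMinOn_pBarycenter {d N : ℕ} {p : ℝ} (hp : 1 < p) {lam : Fin N → ℝ}
    (hlam : ∀ i, 0 < lam i) (hsum : ∑ i, lam i = 1) (x : Fin N → EuclideanSpace ℝ (Fin d)) :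
    IsMinOn (weightedPowSum p lam x) Set.univ (pBarycenter p lam x) :=
  Classical.epsilon_spec (existsUnique_isMinOn_weightedPowSum hp hlam hsum x).exists

/-- A set `Γ` of `N`-tuples is `c`-monotone if exchanging components between any two of its
elements does not decrease the total cost. -/
def IsCMonotone {N : ℕ} {E : Type*} (c : (Fin N → E) → ℝ) (Γ : Set (Fin N → E)) : Prop :=
  ∀ x : Fin 2 → Fin N → E, (∀ k, x k ∈ Γ) → ∀ σ : Fin N → Equiv.Perm (Fin 2),
    c (x 0) + c (x 1) ≤ c (fun i => x (σ i 0) i) + c (fun i => x (σ i 1) i)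

/-- `Π(μ 0, …, μ (N - 1))`: probability measures on the product with marginals `μ i`. -/
def multiPlans {N : ℕ} {E : Type*} [MeasurableSpace E] (μ : Fin N → Measure E) :
    Set (Measure (Fin N → E)) :=
  {γ | IsProbabilityMeasure γ ∧ ∀ i, γ.map (fun x => x i) = μ i}

/-- `Π(μ, ρ)`: transport plans from `μ` to `ρ`. -/
def plans {E : Type*} [MeasurableSpace E] (μ ρ : Measure E) : Set (Measure (E × E)) :=
  {η | IsProbabilityMeasure η ∧ η.map Prod.fst = μ ∧ η.map Prod.snd = ρ}

/-- `P_p(ℝ^d)`: Borel probability measures with finite `p`-th moment. -/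
def probMeasuresFiniteMoment (d : ℕ) (p : ℝ) : Set (Measure (EuclideanSpace ℝ (Fin d))) :=
  {μ | IsProbabilityMeasure μ ∧ ∫⁻ x, ‖x‖ₑ ^ p ∂μ < ∞}

/-- The `p`-Wasserstein distance `W_p(μ, ρ)`, with values in `[0, ∞]`. -/
noncomputable def wassersteinDist {d : ℕ} (p : ℝ)
    (μ ρ : Measure (EuclideanSpace ℝ (Fin d))) : ℝ≥0∞ :=
  ⨅ η ∈ plans μ ρ, (∫⁻ z, ‖z.1 - z.2‖ₑ ^ p ∂η) ^ (1 / p)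

/-- `ν` is a `p`-Wasserstein barycenter of the measures `μ i` with weights `λ i`: it minimizes
`∑ i, λ i * W_p(μ i, ν) ^ p` over `P_p(ℝ^d)`. -/
def IsWassersteinBarycenter {d N : ℕ} (p : ℝ) (lam : Fin N → ℝ)
    (μ : Fin N → Measure (EuclideanSpace ℝ (Fin d)))
    (ν : Measure (EuclideanSpace ℝ (Fin d))) : Prop :=
  ν ∈ probMeasuresFiniteMoment d p ∧
    IsMinOn (fun ρ => ∑ i, ENNReal.ofReal (lam i) * wassersteinDist p (μ i) ρ ^ p)
      (probMeasuresFiniteMoment d p) ν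

/-! The heart is a local inverse-Lipschitz estimate. Let `x`, `y` in a `c`-monotone set be close to
a point `x₀`, with barycenters `z`, `w`. If `x₀ i` differs from its barycenter, and every other `x₀
j` does too unless `2 ≤ p`, then `‖x i - y i‖ ≤ C * ‖z - w‖`
(`exists_nhds_norm_sub_le_pBarycenter`). To see this, put `δ = x i - y i`, exchange the `i`-th
components, and test the two exchanged tuples with `z - t • δ` and `w + t • δ`. As `z` and `w` are
minimizers, moving them costs only `O(t² ‖δ‖²)`, given local Lipschitz bounds on the gradient of
`‖·‖ ^ p`. Strong convexity near the nonzero vector `x₀ i - pBarycenter p lam x₀` yields a gain of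
order `t ‖δ‖²`, up to an error `O(‖δ‖ ‖z - w‖)`. For small `t` the gain beats the cost.

Hence, locally on the support of the plan, the `i`-th component is a Lipschitz function of the
barycenter. The preimage of a null set then has a null `i`-th projection, and is negligible when `μ
i ≪ volume`. Tuples with `x j` equal to the barycenter, for some absolutely continuous `μ j`, need
no estimate: over a null set `s` they satisfy `x j ∈ s`. This gives
`map_pBarycenter_absolutelyContinuous`.

For Wasserstein barycenters, optimal plans from the `μ i` to `ν` are glued along `ν`. Comparison
with the multi-marginal problem shows that the glued plan is optimal and that `ν` is its image under
the barycenter map (`IsWassersteinBarycenter.exists_optimal_multiPlan`). Optimality makes its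
support `c`-monotone (`isCMonotone_support_of_optimal`). -/

open Filter Topology

/-! ### Local smoothness and strong convexity of the `p`-th power of the norm. -/

section NormRpow

variable {E : Type*} [NormedAddCommGroup E] [InnerProductSpace ℝ E]

/-- The gradient of `v ↦ ‖v‖ ^ p`. -/
noncomputable def normRpowGrad (p : ℝ) (v : E) : E := (p * ‖v‖ ^ (p - 2)) • v

theorem hasFDerivAt_norm_rpow_innerSL {p : ℝ} (hp : 1 < p) (v : E) :
    HasFDerivAt (fun x : E => ‖x‖ ^ p) (innerSL ℝ (normRpowGrad p v)) v := by
  rw [normRpowGrad, map_smul]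
  exact hasFDerivAt_norm_rpow v hp

/-- Reduces a vector estimate to a radial one: `‖a • v - b • w‖²` is `(a‖v‖ - b‖w‖)²` plus `2ab`
times the Cauchy–Schwarz defect `‖v‖‖w‖ - ⟪v, w⟫ ≥ 0`, and `a * b ≤ M²`. -/
theorem norm_smul_sub_smul_le {v w : E} {a b M : ℝ} (ha : 0 ≤ a) (hb : 0 ≤ b) (haM : a ≤ M)
    (hbM : b ≤ M) (h : |a * ‖v‖ - b * ‖w‖| ≤ M * |‖v‖ - ‖w‖|) :
    ‖a • v - b • w‖ ≤ M * ‖v - w‖ := by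
  have hM : 0 ≤ M := ha.trans haM
  refine le_of_sq_le_sq ?_ (by positivity)
  rw [mul_pow, norm_sub_sq_real, norm_sub_sq_real, norm_smul, norm_smul, inner_smul_left,
    inner_smul_right, Real.norm_of_nonneg ha, Real.norm_of_nonneg hb]
  simp only [conj_trivial]
  have h1 := real_inner_le_norm v w
  have h2 : (a * ‖v‖ - b * ‖w‖) ^ 2 ≤ M ^ 2 * (‖v‖ - ‖w‖) ^ 2 := by
    rw [← sq_abs, ← sq_abs (‖v‖ - ‖w‖), ← mul_pow]
    exact pow_le_pow_left₀ (abs_nonneg _) h 2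
  have h3 : 0 ≤ M ^ 2 - a * b := by nlinarith
  nlinarith [mul_nonneg h3 (sub_nonneg.2 h1)]

/-- The same radial reduction for monotonicity; here the Cauchy–Schwarz defect carries the
coefficient `a + b`, which is at least `2 * m`. -/
theorem mul_norm_sq_le_inner_smul_sub_smul {v w : E} {a b m : ℝ} (ha : m ≤ a) (hb : m ≤ b)
    (h : m * (‖v‖ - ‖w‖) ^ 2 ≤ (a * ‖v‖ - b * ‖w‖) * (‖v‖ - ‖w‖)) :
    m * ‖v - w‖ ^ 2 ≤ inner ℝ (a • v - b • w) (v - w) := by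
  rw [norm_sub_sq_real, inner_sub_left, inner_sub_right, inner_sub_right]
  simp only [inner_smul_left, conj_trivial, real_inner_self_eq_norm_sq, real_inner_comm v w]
  have h1 := real_inner_le_norm v w
  nlinarith [mul_nonneg (by linarith : 0 ≤ a + b - 2 * m) (sub_nonneg.2 h1)]

theorem rpow_sub_two_mul_self {p : ℝ} (hp : 1 < p) {r : ℝ} (hr : 0 ≤ r) :
    r ^ (p - 2) * r = r ^ (p - 1) := by
  rw [← Real.rpow_add_one' hr (by linarith)]
  ring_nf

theorem eventually_rpow_sub_two_mem {p : ℝ} {r : ℝ} (h : r ≠ 0 ∨ 2 ≤ p) {s : Set ℝ}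
    (hs : s ∈ 𝓝 (r ^ (p - 2))) :
    ∃ ε > 0, ∀ t ∈ Metric.ball r ε, t ^ (p - 2) ∈ s := by
  have : ContinuousAt (fun t : ℝ => t ^ (p - 2)) r :=
    Real.continuousAt_rpow_const _ _ (h.imp_right fun h => by linarith)
  exact Metric.mem_nhds_iff.1 (this hs)

theorem norm_mem_ball_norm {E : Type*} [SeminormedAddCommGroup E] {v v₀ : E} {ε : ℝ} (h : v ∈ Metric.ball v₀ ε) :
    ‖v‖ ∈ Metric.ball ‖v₀‖ ε := by
  rw [mem_ball_iff_norm] at h ⊢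
  exact (abs_norm_sub_norm_le _ _).trans_lt h

/-- The Hessian of `‖v‖ ^ p` has size of order `‖v‖ ^ (p - 2)`, which is locally bounded away from
the origin, and also at the origin when `2 ≤ p`. -/
theorem exists_normRpowGrad_lipschitz {p : ℝ} (hp : 1 < p) {v₀ : E} (h : v₀ ≠ 0 ∨ 2 ≤ p) :
    ∃ ε > 0, ∃ M > 0, ∀ v ∈ Metric.ball v₀ ε, ∀ w ∈ Metric.ball v₀ ε,
      ‖normRpowGrad p v - normRpowGrad p w‖ ≤ M * ‖v - w‖ := by
  obtain ⟨ε, hε, H⟩ := eventually_rpow_sub_two_mem (h.imp_left norm_ne_zero_iff.2)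
    (Iio_mem_nhds (lt_add_one (‖v₀‖ ^ (p - 2))))
  set B := ‖v₀‖ ^ (p - 2) + 1 with hB
  have hB0 : 0 < B := by positivity
  obtain ⟨ε', hε', hsub⟩ : ∃ ε' > 0, ∀ t ∈ Metric.ball ‖v₀‖ ε', t ≠ 0 ∨ 2 ≤ p := by
    rcases h with h | h
    · refine ⟨‖v₀‖, norm_pos_iff.2 h, fun t ht => Or.inl ?_⟩
      rintro rfl
      simp at ht
    · exact ⟨1, one_pos, fun _ _ => Or.inr h⟩
  refine ⟨min ε ε', lt_min hε hε', p * p * B, by positivity, fun v hv w hw => ?_⟩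
  have hv' := norm_mem_ball_norm hv
  have hw' := norm_mem_ball_norm hw
  have hHv := (H _ (Metric.ball_subset_ball (min_le_left _ _) hv')).out
  have hHw := (H _ (Metric.ball_subset_ball (min_le_left _ _) hw')).out
  have key : ∀ t ∈ Metric.ball ‖v₀‖ (min ε ε') ∩ Set.Ici 0,
      ‖(p - 1) * t ^ (p - 2)‖ ≤ p * B := by
    intro t ht
    have h0 : 0 ≤ t ^ (p - 2) := Real.rpow_nonneg ht.2 _
    rw [Real.norm_of_nonneg (mul_nonneg (by linarith) h0)]
    have := (H _ (Metric.ball_subset_ball (min_le_left _ _) ht.1)).out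
    nlinarith
  have hmvt := ((convex_ball ‖v₀‖ (min ε ε')).inter (convex_Ici 0)).norm_image_sub_le_of_norm_hasDerivWithin_le
    (f := fun t : ℝ => t ^ (p - 1)) (f' := fun t => (p - 1) * t ^ (p - 2)) (C := p * B)
    (fun t ht => by
      have := Real.hasDerivAt_rpow_const (x := t) (p := p - 1)
        ((hsub t (Metric.ball_subset_ball (min_le_right _ _) ht.1)).imp_right
          fun h => by linarith)
      rw [show p - 1 - 1 = p - 2 by ring] at this
      exact this.hasDerivWithinAt) key ⟨hw', norm_nonneg w⟩ ⟨hv', norm_nonneg v⟩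
  have hpp : p * B ≤ p * p * B := by nlinarith [mul_pos (by linarith : 0 < p) hB0]
  refine norm_smul_sub_smul_le (by positivity) (by positivity)
    ((by gcongr : p * ‖v‖ ^ (p - 2) ≤ p * B).trans hpp)
    ((by gcongr : p * ‖w‖ ^ (p - 2) ≤ p * B).trans hpp) ?_
  rw [mul_assoc, mul_assoc, rpow_sub_two_mul_self hp (norm_nonneg v),
    rpow_sub_two_mul_self hp (norm_nonneg w), ← mul_sub, abs_mul, abs_of_pos (by linarith : 0 < p),
    mul_assoc p p, mul_assoc p]
  gcongr
  simpa using hmvt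

theorem exists_normRpowGrad_strongMono {p : ℝ} (hp : 1 < p) {v₀ : E} (h : v₀ ≠ 0) :
    ∃ ε > 0, ∃ m > 0, ∀ v ∈ Metric.ball v₀ ε, ∀ w ∈ Metric.ball v₀ ε,
      m * ‖v - w‖ ^ 2 ≤ inner ℝ (normRpowGrad p v - normRpowGrad p w) (v - w) := by
  have hv0 : 0 < ‖v₀‖ := norm_pos_iff.2 h
  set B := ‖v₀‖ ^ (p - 2) / 2 with hB
  have hB0 : 0 < B := by positivity
  obtain ⟨ε, hε, H⟩ := eventually_rpow_sub_two_mem (p := p) (Or.inl hv0.ne')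
    (Ioi_mem_nhds (half_lt_self (by positivity : 0 < ‖v₀‖ ^ (p - 2))))
  have hne : ∀ t ∈ Metric.ball ‖v₀‖ (min ε ‖v₀‖), 0 < t := by
    intro t ht
    have := Metric.ball_subset_ball (min_le_right _ _) ht
    rw [mem_ball_iff_norm, Real.norm_eq_abs, abs_lt] at this
    linarith
  -- The tangential and radial eigenvalues of the Hessian are `p * ‖v‖ ^ (p - 2)` times `1` and `p -
  -- 1`.
  set c := min 1 (p - 1) with hc
  have hc0 : 0 < c := lt_min one_pos (by linarith)
  refine ⟨min ε ‖v₀‖, lt_min hε hv0, p * (c * B), by positivity, fun v hv w hw => ?_⟩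
  have hv' := norm_mem_ball_norm hv
  have hw' := norm_mem_ball_norm hw
  have hHv := (H _ (Metric.ball_subset_ball (min_le_left _ _) hv')).out
  have hHw := (H _ (Metric.ball_subset_ball (min_le_left _ _) hw')).out
  have hder : ∀ t ∈ Metric.ball ‖v₀‖ (min ε ‖v₀‖),
      HasDerivAt (fun t : ℝ => t ^ (p - 1)) ((p - 1) * t ^ (p - 2)) t := by
    intro t ht
    have := Real.hasDerivAt_rpow_const (x := t) (p := p - 1) (Or.inl (hne t ht).ne')
    rwa [show p - 1 - 1 = p - 2 by ring] at this
  have hmvt : ∀ s ∈ Metric.ball ‖v₀‖ (min ε ‖v₀‖), ∀ t ∈ Metric.ball ‖v₀‖ (min ε ‖v₀‖), s ≤ t →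
      c * B * (t - s) ≤ t ^ (p - 1) - s ^ (p - 1) :=
    (convex_ball ‖v₀‖ (min ε ‖v₀‖)).mul_sub_le_image_sub_of_le_deriv
      (fun t ht => (hder t ht).continuousAt.continuousWithinAt)
      (fun t ht => (hder t (interior_subset ht)).differentiableAt.differentiableWithinAt)
      (fun t ht => by
        rw [(hder t (interior_subset ht)).deriv]
        have h1 := (H _ (Metric.ball_subset_ball (min_le_left _ _) (interior_subset ht))).out
        exact mul_le_mul (min_le_right _ _) h1.le hB0.le (by linarith))
  have hcB : c * B ≤ B := mul_le_of_le_one_left hB0.le (min_le_left _ _)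
  refine mul_norm_sq_le_inner_smul_sub_smul
    (mul_le_mul_of_nonneg_left (hcB.trans hHv.le) (by linarith))
    (mul_le_mul_of_nonneg_left (hcB.trans hHw.le) (by linarith)) ?_
  rw [mul_assoc p (‖v‖ ^ _), mul_assoc p (‖w‖ ^ _), rpow_sub_two_mul_self hp (norm_nonneg v),
    rpow_sub_two_mul_self hp (norm_nonneg w), ← mul_sub, mul_assoc p (c * B), mul_assoc p (_ - _)]
  refine mul_le_mul_of_nonneg_left ?_ (by linarith)
  rcases le_total ‖v‖ ‖w‖ with hle | hle
  · have := hmvt _ hv' _ hw' hle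
    nlinarith
  · have := hmvt _ hw' _ hv' hle
    nlinarith

/-- Mean value inequality for the increment `u ↦ ‖u + a‖ ^ p - ‖u‖ ^ p`, whose gradient has norm at
most `M * ‖a‖`. -/
theorem abs_mixed_difference_norm_rpow_le {p : ℝ} (hp : 1 < p) {B : Set E} (hB : Convex ℝ B)
    {M : ℝ} (hM : ∀ v ∈ B, ∀ w ∈ B, ‖normRpowGrad p v - normRpowGrad p w‖ ≤ M * ‖v - w‖)
    {v a b : E} (h1 : v ∈ B) (h2 : v + a ∈ B) (h3 : v + b ∈ B) (h4 : v + a + b ∈ B) :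
    |‖v + a + b‖ ^ p - ‖v + b‖ ^ p - (‖v + a‖ ^ p - ‖v‖ ^ p)| ≤ M * ‖a‖ * ‖b‖ := by
  have hconv : Convex ℝ (B ∩ (fun u => u + a) ⁻¹' B) := hB.inter (hB.translate_preimage_left a)
  have key := hconv.norm_image_sub_le_of_norm_hasFDerivWithin_le
    (f := fun u : E => ‖u + a‖ ^ p - ‖u‖ ^ p)
    (f' := fun u => innerSL ℝ (normRpowGrad p (u + a)) - innerSL ℝ (normRpowGrad p u))
    (C := M * ‖a‖) (x := v) (y := v + b) (𝕜 := ℝ)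
    (fun u _ => (((hasFDerivAt_comp_add_right a).2 (hasFDerivAt_norm_rpow_innerSL hp (u + a))).sub
      (hasFDerivAt_norm_rpow_innerSL hp u)).hasFDerivWithinAt)
    (fun u hu => by
      rw [← map_sub, innerSL_apply_norm]
      simpa using hM _ hu.2 _ hu.1)
    ⟨h1, h2⟩ ⟨h3, by simpa [add_right_comm] using h4⟩
  simpa [add_right_comm v b a] using key

/-- A lower bound is available because both increments are parallel to `a`: the derivative along the
segment is a gradient difference tested against the displacement `a` itself. -/
theorem mul_norm_sq_le_mixed_difference_norm_rpow {p : ℝ} (hp : 1 < p) {B : Set E}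
    (hB : Convex ℝ B) {m : ℝ}
    (hm : ∀ v ∈ B, ∀ w ∈ B,
      m * ‖v - w‖ ^ 2 ≤ inner ℝ (normRpowGrad p v - normRpowGrad p w) (v - w))
    {v a : E} {s : ℝ} (hs : 0 ≤ s) (h1 : v ∈ B) (h2 : v + a ∈ B) (h3 : v + s • a ∈ B)
    (h4 : v + a + s • a ∈ B) :
    m * s * ‖a‖ ^ 2 ≤ ‖v + a + s • a‖ ^ p - ‖v + s • a‖ ^ p - (‖v + a‖ ^ p - ‖v‖ ^ p) := by
  have hline : ∀ w t, HasDerivAt (fun t : ℝ => ‖w + t • a‖ ^ p)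
      (inner ℝ (normRpowGrad p (w + t • a)) a) t := by
    intro w t
    have h := (hasFDerivAt_norm_rpow_innerSL hp (w + t • a)).comp_hasDerivAt t
      (((hasDerivAt_id t).smul_const a).const_add w)
    simpa [Function.comp_def] using h
  have hmem : ∀ t ∈ Set.Icc 0 s, v + t • a ∈ B ∧ v + a + t • a ∈ B := by
    intro t ht
    rcases hs.eq_or_lt with rfl | hs0
    · obtain rfl : t = 0 := le_antisymm ht.2 ht.1
      simpa using ⟨h1, h2⟩
    have hu0 : 0 ≤ t / s := div_nonneg ht.1 hs
    have hu1 : t / s ≤ 1 := div_le_one_of_le₀ ht.2 hs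
    have hu : (t / s) • s • a = t • a := by rw [smul_smul, div_mul_cancel₀ _ hs0.ne']
    constructor
    · have := hB.add_smul_mem h1 h3 ⟨hu0, hu1⟩
      rwa [hu] at this
    · have := hB.add_smul_mem h2 h4 ⟨hu0, hu1⟩
      rwa [hu] at this
  have hd : ∀ t, HasDerivAt (fun t : ℝ => ‖v + a + t • a‖ ^ p - ‖v + t • a‖ ^ p)
      (inner ℝ (normRpowGrad p (v + a + t • a)) a - inner ℝ (normRpowGrad p (v + t • a)) a) t :=
    fun t => (hline (v + a) t).sub (hline v t)
  have key := (convex_Icc (0 : ℝ) s).mul_sub_le_image_sub_of_le_deriv (C := m * ‖a‖ ^ 2)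
    (fun t _ => (hd t).continuousAt.continuousWithinAt)
    (fun t _ => (hd t).differentiableAt.differentiableWithinAt)
    (fun t ht => by
      obtain ⟨hv, hw⟩ := hmem t (interior_subset ht)
      rw [(hd t).deriv, ← inner_sub_left]
      have := hm _ hw _ hv
      rwa [show v + a + t • a - (v + t • a) = a by abel] at this)
    0 (Set.left_mem_Icc.2 hs) s (Set.right_mem_Icc.2 hs) hs
  simp only [zero_smul, add_zero, sub_zero] at key
  linarith

end NormRpow

/-! ### Continuity of the barycenter of points and the local injectivity estimate. -/

section Barycenter

variable {d N : ℕ} {p : ℝ} {lam : Fin N → ℝ}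

theorem continuous_weightedPowSum (hp : 1 < p) :
    Continuous fun q : (Fin N → EuclideanSpace ℝ (Fin d)) × EuclideanSpace ℝ (Fin d) =>
      weightedPowSum p lam q.1 q.2 := by
  unfold weightedPowSum
  refine continuous_finsetSum _ fun i _ => continuous_const.mul ?_
  exact (((continuous_apply i).comp continuous_fst).sub continuous_snd).norm.rpow_const
    fun _ => Or.inr (by linarith)

theorem weightedPowSum_pBarycenter_le (hp : 1 < p) (hlam : ∀ i, 0 < lam i)
    (hsum : ∑ i, lam i = 1) (x : Fin N → EuclideanSpace ℝ (Fin d))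
    (z : EuclideanSpace ℝ (Fin d)) :
    weightedPowSum p lam x (pBarycenter p lam x) ≤ weightedPowSum p lam x z :=
  isMinOn_pBarycenter hp hlam hsum x (Set.mem_univ z)

theorem pCost_le (hp : 1 < p) (hlam : ∀ i, 0 < lam i) (hsum : ∑ i, lam i = 1)
    (x : Fin N → EuclideanSpace ℝ (Fin d)) (z : EuclideanSpace ℝ (Fin d)) :
    pCost p lam x ≤ weightedPowSum p lam x z :=
  weightedPowSum_pBarycenter_le hp hlam hsum x z

theorem eq_pBarycenter_of_le (hp : 1 < p) (hlam : ∀ i, 0 < lam i) (hsum : ∑ i, lam i = 1)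
    {x : Fin N → EuclideanSpace ℝ (Fin d)} {z : EuclideanSpace ℝ (Fin d)}
    (h : weightedPowSum p lam x z ≤ pCost p lam x) : z = pBarycenter p lam x :=
  (existsUnique_isMinOn_weightedPowSum hp hlam hsum x).unique
    (fun y _ => h.trans (pCost_le hp hlam hsum x y)) (isMinOn_pBarycenter hp hlam hsum x)

theorem mul_norm_rpow_le_weightedPowSum (hlam : ∀ i, 0 < lam i)
    (x : Fin N → EuclideanSpace ℝ (Fin d)) (z : EuclideanSpace ℝ (Fin d)) (i : Fin N) :
    lam i * ‖x i - z‖ ^ p ≤ weightedPowSum p lam x z :=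
  Finset.single_le_sum (f := fun i => lam i * ‖x i - z‖ ^ p)
    (fun i _ => mul_nonneg (hlam i).le (Real.rpow_nonneg (norm_nonneg _) _)) (Finset.mem_univ i)

/-- Barycenters stay in a compact ball for nearby tuples, and any limit of minimizers is a minimizer
at the limit tuple, hence the unique one. -/
theorem continuous_pBarycenter (hp : 1 < p) (hlam : ∀ i, 0 < lam i) (hsum : ∑ i, lam i = 1) :
    Continuous (pBarycenter (d := d) p lam) := by
  have hp0 : 0 < p := by linarith
  obtain ⟨i₀⟩ : Nonempty (Fin N) := by
    by_contra h
    rw [not_nonempty_iff] at h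
    simp at hsum
  rw [continuous_iff_ultrafilter]
  intro x₀ g hg
  have hF := continuous_weightedPowSum (d := d) (lam := lam) hp
  have hbd : ∀ᶠ x in 𝓝 x₀, pBarycenter p lam x ∈ Metric.closedBall (0 : EuclideanSpace ℝ (Fin d))
      (‖x₀ i₀‖ + 1 + ((weightedPowSum p lam x₀ 0 + 1) / lam i₀) ^ (1 / p)) := by
    have h1 : ∀ᶠ x in 𝓝 x₀, weightedPowSum p lam x 0 < weightedPowSum p lam x₀ 0 + 1 :=
      (hF.comp (continuous_id.prodMk continuous_const)).continuousAt.eventually_lt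
        continuousAt_const (lt_add_one _)
    have h2 : ∀ᶠ x in 𝓝 x₀, ‖x i₀‖ < ‖x₀ i₀‖ + 1 :=
      (continuous_apply i₀).norm.continuousAt.eventually_lt continuousAt_const (lt_add_one _)
    filter_upwards [h1, h2] with x hx1 hx2
    have h3 := (mul_norm_rpow_le_weightedPowSum (p := p) hlam x (pBarycenter p lam x) i₀).trans
      (weightedPowSum_pBarycenter_le hp hlam hsum x 0)
    have h4 : ‖x i₀ - pBarycenter p lam x‖ ^ p ≤ (weightedPowSum p lam x₀ 0 + 1) / lam i₀ := by
      rw [le_div_iff₀ (hlam i₀)]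
      linarith
    have h5 : ‖x i₀ - pBarycenter p lam x‖ ≤
        ((weightedPowSum p lam x₀ 0 + 1) / lam i₀) ^ (1 / p) := by
      have := Real.rpow_le_rpow (Real.rpow_nonneg (norm_nonneg _) _) h4 (by positivity :
        0 ≤ 1 / p)
      rwa [one_div, Real.rpow_rpow_inv (norm_nonneg _) hp0.ne', ← one_div] at this
    rw [mem_closedBall_zero_iff]
    have := norm_sub_norm_le (pBarycenter p lam x) (x i₀)
    rw [norm_sub_rev] at this
    linarith
  obtain ⟨z, -, hz⟩ := (isCompact_closedBall _ _).ultrafilter_le_nhds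
    (g.map (pBarycenter p lam)) (le_principal_iff.2 (Ultrafilter.mem_map.2 (hg hbd)))
  have hz' : Tendsto (pBarycenter p lam) g (𝓝 z) := hz
  have hid : Tendsto (fun x => x) (g : Filter (Fin N → EuclideanSpace ℝ (Fin d))) (𝓝 x₀) := hg
  have hlim : ∀ {h : (Fin N → EuclideanSpace ℝ (Fin d)) → EuclideanSpace ℝ (Fin d)} {y},
      Tendsto h g (𝓝 y) →
        Tendsto (fun x => weightedPowSum p lam x (h x)) g (𝓝 (weightedPowSum p lam x₀ y)) :=
    fun {h y} hy => Tendsto.comp (g := fun q : (Fin N → EuclideanSpace ℝ (Fin d)) ×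
      EuclideanSpace ℝ (Fin d) => weightedPowSum p lam q.1 q.2) (f := fun x => (x, h x))
      (hF.tendsto (x₀, y)) (hid.prodMk_nhds hy)
  have hmin : ∀ y, weightedPowSum p lam x₀ z ≤ weightedPowSum p lam x₀ y := fun y =>
    le_of_tendsto_of_tendsto (hlim hz') (hlim tendsto_const_nhds)
      (Eventually.of_forall fun x => weightedPowSum_pBarycenter_le hp hlam hsum x y)
  rwa [← eq_pBarycenter_of_le hp hlam hsum (hmin _)]

theorem weightedPowSum_nonneg (hlam : ∀ i, 0 < lam i) (x : Fin N → EuclideanSpace ℝ (Fin d))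
    (z : EuclideanSpace ℝ (Fin d)) : 0 ≤ weightedPowSum p lam x z :=
  Finset.sum_nonneg fun i _ => mul_nonneg (hlam i).le (Real.rpow_nonneg (norm_nonneg _) _)

theorem continuous_pCost (hp : 1 < p) (hlam : ∀ i, 0 < lam i) (hsum : ∑ i, lam i = 1) :
    Continuous (pCost (d := d) p lam) :=
  Continuous.comp (g := fun q : (Fin N → EuclideanSpace ℝ (Fin d)) × EuclideanSpace ℝ (Fin d) =>
      weightedPowSum p lam q.1 q.2) (f := fun x => (x, pBarycenter p lam x))
    (continuous_weightedPowSum hp)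
    (continuous_id.prodMk (continuous_pBarycenter hp hlam hsum))

theorem weightedPowSum_update (x : Fin N → EuclideanSpace ℝ (Fin d))
    (z a : EuclideanSpace ℝ (Fin d)) (i : Fin N) :
    weightedPowSum p lam (Function.update x i a) z =
      weightedPowSum p lam x z + lam i * (‖a - z‖ ^ p - ‖x i - z‖ ^ p) := by
  unfold weightedPowSum
  rw [← Finset.add_sum_erase _ _ (Finset.mem_univ i),
    ← Finset.add_sum_erase _ (fun j => lam j * ‖x j - z‖ ^ p) (Finset.mem_univ i)]
  have : ∑ j ∈ Finset.univ.erase i, lam j * ‖Function.update x i a j - z‖ ^ p =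
      ∑ j ∈ Finset.univ.erase i, lam j * ‖x j - z‖ ^ p :=
    Finset.sum_congr rfl fun j hj => by
      rw [Function.update_of_ne (Finset.ne_of_mem_erase hj)]
  rw [this, Function.update_self]
  ring

/-- Exchanging a single component between two points of a `c`-monotone set. -/
theorem IsCMonotone.le_update {E : Type*} {c : (Fin N → E) → ℝ} {Γ : Set (Fin N → E)}
    (h : IsCMonotone c Γ) {x y : Fin N → E} (hx : x ∈ Γ) (hy : y ∈ Γ) (i : Fin N) :
    c x + c y ≤ c (Function.update x i (y i)) + c (Function.update y i (x i)) := by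
  have := h ![x, y] (by simp [Fin.forall_fin_two, hx, hy])
    (fun j => if j = i then Equiv.swap 0 1 else 1)
  convert this using 3
  all_goals
    funext j
    by_cases hj : j = i
    · subst hj; simp
    · simp [hj]

/-- Quadratic upper bound of the sum around its minimizer. -/
theorem weightedPowSum_le_add (hp : 1 < p) (hlam : ∀ i, 0 < lam i) (hsum : ∑ i, lam i = 1)
    {B : Fin N → Set (EuclideanSpace ℝ (Fin d))} (hB : ∀ j, Convex ℝ (B j)) {M : ℝ}
    (hM : ∀ j, ∀ v ∈ B j, ∀ w ∈ B j, ‖normRpowGrad p v - normRpowGrad p w‖ ≤ M * ‖v - w‖)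
    {x : Fin N → EuclideanSpace ℝ (Fin d)} {h : EuclideanSpace ℝ (Fin d)}
    (h1 : ∀ j, x j - pBarycenter p lam x + h ∈ B j) (h2 : ∀ j, x j - pBarycenter p lam x - h ∈ B j) :
    weightedPowSum p lam x (pBarycenter p lam x + h) ≤ pCost p lam x + M * ‖h‖ ^ 2 := by
  set z := pBarycenter p lam x with hz
  have hmid : ∀ j, x j - z ∈ B j := fun j => by
    have := (hB j) (h1 j) (h2 j) (by norm_num : (0 : ℝ) ≤ 1 / 2) (by norm_num : (0 : ℝ) ≤ 1 / 2)
      (by norm_num)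
    convert this using 1
    module
  -- The symmetric second difference has no first-order term, so the gradient of the sum at its
  -- minimizer is never needed; the value at `z - h` is then bounded below by the minimum.
  have key : weightedPowSum p lam x (z + h) + weightedPowSum p lam x (z - h) ≤
      2 * weightedPowSum p lam x z + M * ‖h‖ ^ 2 := by
    have : M * ‖h‖ ^ 2 = ∑ j, lam j * (M * ‖h‖ ^ 2) := by rw [← Finset.sum_mul, hsum, one_mul]
    rw [this]
    unfold weightedPowSum
    rw [Finset.mul_sum, ← Finset.sum_add_distrib, ← Finset.sum_add_distrib]
    refine Finset.sum_le_sum fun j _ => ?_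
    have e1 : x j - z - h + h = x j - z := by abel
    have e2 : x j - z - h = x j - (z + h) := by abel
    have e3 : x j - z + h = x j - (z - h) := by abel
    have hd := abs_mixed_difference_norm_rpow_le hp (hB j) (hM j) (h2 j)
      (a := h) (b := h) (by rw [e1]; exact hmid j) (by rw [e1]; exact hmid j)
      (by rw [e1]; exact h1 j)
    rw [e1, e2, e3] at hd
    have := (le_abs_self _).trans hd
    nlinarith [hlam j]
  have := weightedPowSum_pBarycenter_le hp hlam hsum x (z - h)
  rw [← hz] at this
  change _ ≤ weightedPowSum p lam x z + _
  linarith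

/-- The local injectivity estimate for the barycenter map on `c`-monotone sets. -/
theorem exists_nhds_norm_sub_le_pBarycenter (hp : 1 < p) (hlam : ∀ i, 0 < lam i)
    (hsum : ∑ i, lam i = 1) {Γ : Set (Fin N → EuclideanSpace ℝ (Fin d))}
    (hΓ : IsCMonotone (pCost p lam) Γ) {x₀ : Fin N → EuclideanSpace ℝ (Fin d)} {i : Fin N}
    (hi : x₀ i ≠ pBarycenter p lam x₀) (hx₀ : ∀ j, x₀ j ≠ pBarycenter p lam x₀ ∨ 2 ≤ p) :
    ∃ U ∈ 𝓝 x₀, ∃ C : ℝ, ∀ x ∈ U ∩ Γ, ∀ y ∈ U ∩ Γ,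
      ‖x i - y i‖ ≤ C * ‖pBarycenter p lam x - pBarycenter p lam y‖ := by
  set z₀ := pBarycenter p lam x₀ with hz₀
  choose ε hε M hM hL using fun j => exists_normRpowGrad_lipschitz hp
    ((hx₀ j).imp_left sub_ne_zero.2)
  obtain ⟨ε', hε', m, hm, hS⟩ := exists_normRpowGrad_strongMono hp (sub_ne_zero.2 hi)
  obtain ⟨r, hr, hrε, hrε'⟩ : ∃ r > 0, (∀ j, r ≤ ε j) ∧ r ≤ ε' := by
    have : Nonempty (Fin N) := ⟨i⟩
    obtain ⟨j, hj⟩ := Finite.exists_min ε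
    exact ⟨min (ε j) ε', lt_min (hε j) hε', fun k => (min_le_left _ _).trans (hj k),
      min_le_right _ _⟩
  set B := fun j => Metric.ball (x₀ j - z₀) r with hBdef
  set K := ∑ j, M j with hK
  have hKM : ∀ j, M j ≤ K := fun j =>
    Finset.single_le_sum (fun j _ => (hM j).le) (Finset.mem_univ j)
  have hK0 : 0 < K := (hM i).trans_le (hKM i)
  have hconv : ∀ j, Convex ℝ (B j) := fun j => convex_ball _ _
  have hL' : ∀ j, ∀ v ∈ B j, ∀ w ∈ B j,
      ‖normRpowGrad p v - normRpowGrad p w‖ ≤ K * ‖v - w‖ := fun j v hv w hw =>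
    (hL j v (Metric.ball_subset_ball (hrε j) hv) w (Metric.ball_subset_ball (hrε j) hw)).trans
      (by gcongr; exact hKM j)
  have hS' : ∀ v ∈ B i, ∀ w ∈ B i,
      m * ‖v - w‖ ^ 2 ≤ inner ℝ (normRpowGrad p v - normRpowGrad p w) (v - w) := fun v hv w hw =>
    hS v (Metric.ball_subset_ball hrε' hv) w (Metric.ball_subset_ball hrε' hw)
  -- Chosen so that the cost `2 * K * t²` of moving the two minimizers absorbs at most half of the
  -- gain `2 * lam i * m * t`.
  set t := min 1 (lam i * m / (2 * K)) with ht
  have ht0 : 0 < t := lt_min one_pos (div_pos (mul_pos (hlam i) hm) (by positivity))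
  have ht1 : t ≤ 1 := min_le_left _ _
  have htK : K * t ≤ lam i * m / 2 := by
    have : t ≤ lam i * m / (2 * K) := min_le_right _ _
    rw [le_div_iff₀ (by positivity)] at this
    linarith
  -- With `r / 8` for tuple and barycenter, `‖δ‖ < r / 4`, and all vectors below stay within `r / 8
  -- + r / 8 + r / 4 < r` of `x₀ j - z₀`.
  refine ⟨{x | (∀ j, ‖x j - x₀ j‖ < r / 8) ∧ ‖pBarycenter p lam x - z₀‖ < r / 8}, ?_,
    K / (t * m), ?_⟩
  · have h1 : ∀ᶠ x in 𝓝 x₀, ∀ j, ‖x j - x₀ j‖ < r / 8 :=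
      eventually_all.2 fun j => ((continuous_apply j).sub continuous_const).norm.continuousAt
        |>.eventually_lt continuousAt_const (by simp; positivity)
    have h2 : ∀ᶠ x in 𝓝 x₀, ‖pBarycenter p lam x - z₀‖ < r / 8 :=
      ((continuous_pBarycenter hp hlam hsum).sub continuous_const).norm.continuousAt
        |>.eventually_lt continuousAt_const (by simp; positivity)
    exact h1.and h2
  rintro x ⟨⟨hx, hxz⟩, hxΓ⟩ y ⟨⟨hy, hyz⟩, hyΓ⟩
  set z := pBarycenter p lam x with hz
  set w := pBarycenter p lam y with hw
  set δ := x i - y i with hδ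
  have hδr : ‖δ‖ < r / 4 := by
    have : δ = (x i - x₀ i) - (y i - x₀ i) := by rw [hδ]; abel
    rw [this]
    linarith [norm_sub_le (x i - x₀ i) (y i - x₀ i), hx i, hy i]
  have htδ : ‖t • δ‖ < r / 4 := by
    rw [norm_smul, Real.norm_of_nonneg ht0.le]
    exact (mul_le_of_le_one_left (norm_nonneg _) ht1).trans_lt hδr
  have mem : ∀ (j : Fin N) (a b h : EuclideanSpace ℝ (Fin d)), ‖a - x₀ j‖ < r / 8 →
      ‖b - z₀‖ < r / 8 → ‖h‖ < r / 4 → a - b + h ∈ B j := by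
    intro j a b h ha hb hh
    rw [hBdef, mem_ball_iff_norm]
    have : a - b + h - (x₀ j - z₀) = (a - x₀ j) - (b - z₀) + h := by abel
    rw [this]
    linarith [norm_add_le ((a - x₀ j) - (b - z₀)) h, norm_sub_le (a - x₀ j) (b - z₀)]
  have htδ' : ‖-(t • δ)‖ < r / 4 := by rwa [norm_neg]
  have hsq : ‖t • δ‖ ^ 2 = t ^ 2 * ‖δ‖ ^ 2 := by
    rw [norm_smul, Real.norm_of_nonneg ht0.le, mul_pow]
  -- the competitors
  have hX : weightedPowSum p lam x (z - t • δ) ≤ pCost p lam x + K * (t ^ 2 * ‖δ‖ ^ 2) := by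
    have := weightedPowSum_le_add hp hlam hsum hconv hL' (x := x) (h := -(t • δ))
      (fun j => mem j _ _ _ (hx j) hxz htδ')
      (fun j => by simpa using mem j _ _ _ (hx j) hxz htδ)
    rwa [norm_neg, hsq, ← sub_eq_add_neg] at this
  have hY : weightedPowSum p lam y (w + t • δ) ≤ pCost p lam y + K * (t ^ 2 * ‖δ‖ ^ 2) := by
    have := weightedPowSum_le_add hp hlam hsum hconv hL' (x := y) (h := t • δ)
      (fun j => mem j _ _ _ (hy j) hyz htδ)
      (fun j => by simpa [sub_eq_add_neg] using mem j _ _ _ (hy j) hyz htδ')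
    rwa [hsq] at this
  have hswap := hΓ.le_update hxΓ hyΓ i
  have hX' := pCost_le hp hlam hsum (Function.update x i (y i)) (z - t • δ)
  have hY' := pCost_le hp hlam hsum (Function.update y i (x i)) (w + t • δ)
  rw [weightedPowSum_update] at hX' hY'
  -- the mixed differences
  have hupper : ‖x i - (w + t • δ)‖ ^ p - ‖x i - (z + t • δ)‖ ^ p -
      (‖y i - (w + t • δ)‖ ^ p - ‖y i - (z + t • δ)‖ ^ p) ≤ K * ‖δ‖ * ‖z - w‖ := by
    have e1 : y i - (z + t • δ) + δ = x i - (z + t • δ) := by rw [hδ]; abel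
    have e2 : y i - (z + t • δ) + (z - w) = y i - (w + t • δ) := by abel
    have e3 : y i - (z + t • δ) + δ + (z - w) = x i - (w + t • δ) := by rw [hδ]; abel
    have hd := abs_mixed_difference_norm_rpow_le hp (hconv i) (hL' i)
      (v := y i - (z + t • δ)) (a := δ) (b := z - w)
      (by convert mem i _ _ _ (hy i) hxz htδ' using 1; abel)
      (by rw [e1]; convert mem i _ _ _ (hx i) hxz htδ' using 1; abel)
      (by rw [e2]; convert mem i _ _ _ (hy i) hyz htδ' using 1; abel)
      (by rw [e3]; convert mem i _ _ _ (hx i) hyz htδ' using 1; abel)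
    rw [e3, e2, e1] at hd
    have := (le_abs_self _).trans hd
    linarith
  have hlower : m * (2 * t) * ‖δ‖ ^ 2 ≤ ‖x i - (z - t • δ)‖ ^ p - ‖y i - (z - t • δ)‖ ^ p -
      (‖x i - (z + t • δ)‖ ^ p - ‖y i - (z + t • δ)‖ ^ p) := by
    have e1 : y i - (z + t • δ) + δ = x i - (z + t • δ) := by rw [hδ]; abel
    have e2 : y i - (z + t • δ) + (2 * t) • δ = y i - (z - t • δ) := by module
    have e3 : y i - (z + t • δ) + δ + (2 * t) • δ = x i - (z - t • δ) := by
      rw [e1]; module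
    have hd := mul_norm_sq_le_mixed_difference_norm_rpow hp (hconv i) hS'
      (v := y i - (z + t • δ)) (a := δ) (s := 2 * t) (by positivity)
      (by convert mem i _ _ _ (hy i) hxz htδ' using 1; abel)
      (by rw [e1]; convert mem i _ _ _ (hx i) hxz htδ' using 1; abel)
      (by rw [e2]; convert mem i _ _ _ (hy i) hxz htδ using 1; abel)
      (by rw [e3]; convert mem i _ _ _ (hx i) hxz htδ using 1; abel)
    rwa [e3, e2, e1] at hd
  -- The exchange inequality compares base points `z - t • δ` and `w + t • δ`; inserting `z + t • δ`
  -- splits it into `hlower` and `hupper`.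
  have hfin : lam i * (m * (2 * t) * ‖δ‖ ^ 2) ≤
      2 * (K * (t ^ 2 * ‖δ‖ ^ 2)) + lam i * (K * ‖δ‖ * ‖z - w‖) := by
    have := mul_le_mul_of_nonneg_left (sub_le_sub hupper hlower) (hlam i).le
    nlinarith
  have hfin2 : lam i * (t * m * ‖δ‖ ^ 2) ≤ lam i * (K * ‖δ‖ * ‖z - w‖) := by
    have := mul_le_mul_of_nonneg_right htK (by positivity : 0 ≤ t * ‖δ‖ ^ 2)
    nlinarith
  have hfin3 := le_of_mul_le_mul_left hfin2 (hlam i)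
  rw [div_mul_eq_mul_div, le_div_iff₀ (by positivity)]
  rcases (norm_nonneg δ).eq_or_lt with h0 | h0
  · rw [← h0, zero_mul]; positivity
  · refine le_of_mul_le_mul_left ?_ h0
    nlinarith

end Barycenter

/-! ### Absolute continuity of the image of a `c`-monotone plan. -/

section AbsolutelyContinuous

variable {d N : ℕ} {p : ℝ} {lam : Fin N → ℝ}

/-- Haar measure and Hausdorff measure of full dimension have the same null sets, and Lipschitz maps
distort the latter by a constant factor. -/
theorem addHaar_image_eq_zero_of_lipschitzOnWith {E : Type*} [NormedAddCommGroup E]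
    [NormedSpace ℝ E] [FiniteDimensional ℝ E] [MeasurableSpace E] [BorelSpace E]
    (μ : Measure E) [μ.IsAddHaarMeasure] {K : NNReal} {f : E → E} {s : Set E}
    (hf : LipschitzOnWith K f s) (hs : μ s = 0) : μ (f '' s) = 0 := by
  have h1 : Measure.hausdorffMeasure (Module.finrank ℝ E) s = 0 :=
    (Measure.absolutelyContinuous_isAddHaarMeasure _ μ) hs
  have h2 := hf.hausdorffMeasure_image_le (Nat.cast_nonneg (Module.finrank ℝ E))
  rw [h1, mul_zero] at h2
  exact (Measure.absolutelyContinuous_isAddHaarMeasure μ _) (le_antisymm h2 zero_le)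

theorem measure_eq_zero_of_map_eval {E : Type*} [MeasurableSpace E] {μ : Fin N → Measure E}
    {γ : Measure (Fin N → E)} (hγ : γ ∈ multiPlans μ) {i : Fin N} {s : Set E} (hs : μ i s = 0) :
    γ {x | x i ∈ s} = 0 := by
  rw [← hγ.2 i] at hs
  exact Measure.preimage_null_of_map_null (measurable_pi_apply i).aemeasurable hs

theorem map_pBarycenter_absolutelyContinuous (hp : 1 < p) (hlam : ∀ i, 0 < lam i)
    (hsum : ∑ i, lam i = 1) {μ : Fin N → Measure (EuclideanSpace ℝ (Fin d))}
    (hac : (∀ i, μ i ≪ volume) ∨ (2 ≤ p ∧ ∃ i, μ i ≪ volume))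
    {γ : Measure (Fin N → EuclideanSpace ℝ (Fin d))} (hγ : γ ∈ multiPlans μ)
    (hmono : IsCMonotone (pCost p lam) γ.support) :
    γ.map (pBarycenter p lam) ≪ volume := by
  obtain ⟨i, hi, hj⟩ : ∃ i, μ i ≪ volume ∧ ∀ j, μ j ≪ volume ∨ 2 ≤ p := by
    rcases hac with h | ⟨h, i, hi⟩
    · have : Nonempty (Fin N) := by
        by_contra h
        rw [not_nonempty_iff] at h
        simp at hsum
      exact ⟨Classical.arbitrary _, h _, fun j => Or.inl (h j)⟩
    · exact ⟨i, hi, fun j => Or.inr h⟩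
  have hcont := continuous_pBarycenter (d := d) hp hlam hsum
  refine Measure.AbsolutelyContinuous.mk fun s hs hs0 => ?_
  rw [Measure.map_apply hcont.measurable hs]
  set T := γ.support ∩ {x | x i ≠ pBarycenter p lam x ∧
    ∀ j, x j ≠ pBarycenter p lam x ∨ 2 ≤ p} ∩ pBarycenter p lam ⁻¹' s with hT
  have hT0 : γ T = 0 := by
    -- The estimate is only local, which suffices because the space of tuples is second countable.
    refine measure_null_of_locally_null _ fun x₀ hx₀ => ?_
    obtain ⟨U, hU, C, hC⟩ := exists_nhds_norm_sub_le_pBarycenter hp hlam hsum hmono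
      hx₀.1.2.1 hx₀.1.2.2
    refine ⟨T ∩ U, inter_mem_nhdsWithin _ hU, ?_⟩
    set S := T ∩ U
    have hinj : ∀ x ∈ S, ∀ y ∈ S, ‖x i - y i‖ ≤
        C.toNNReal * ‖pBarycenter p lam x - pBarycenter p lam y‖ := fun x hx y hy =>
      (hC x ⟨hx.2, hx.1.1.1⟩ y ⟨hy.2, hy.1.1.1⟩).trans
        (by gcongr; exact Real.le_coe_toNNReal C)
    -- On `S` the barycenter determines the `i`-th component; `f` is this partial inverse, with the
    -- irrelevant value `0` off the image.
    have hchoice : ∀ z, ∃ a : EuclideanSpace ℝ (Fin d),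
        ∀ x ∈ S, pBarycenter p lam x = z → x i = a := by
      intro z
      by_cases h : ∃ x ∈ S, pBarycenter p lam x = z
      · obtain ⟨x, hx, rfl⟩ := h
        refine ⟨x i, fun y hy hyx => ?_⟩
        have := hinj y hy x hx
        rw [hyx, sub_self, norm_zero, mul_zero] at this
        exact sub_eq_zero.1 (norm_le_zero_iff.1 this)
      · exact ⟨0, fun x hx hxz => absurd ⟨x, hx, hxz⟩ h⟩
    choose f hf using hchoice
    have hlip : LipschitzOnWith C.toNNReal f (pBarycenter p lam '' S) := by
      refine LipschitzOnWith.of_dist_le_mul ?_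
      rintro _ ⟨x, hx, rfl⟩ _ ⟨y, hy, rfl⟩
      rw [← hf _ x hx rfl, ← hf _ y hy rfl, dist_eq_norm, dist_eq_norm]
      exact hinj x hx y hy
    have h0 := hi (addHaar_image_eq_zero_of_lipschitzOnWith volume hlip
      (measure_mono_null (Set.image_subset_iff.2 fun x hx => hx.1.2) hs0))
    refine measure_mono_null (fun x hx => ?_) (measure_eq_zero_of_map_eval hγ h0)
    exact ⟨_, ⟨x, hx, rfl⟩, (hf _ x hx rfl).symm⟩
  -- These sets contain the tuples excluded from `T`: there `x j` equals the barycenter, which lies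
  -- in `s`.
  have hdiag : ∀ j, μ j ≪ volume → γ {x | x j ∈ s} = 0 := fun j h =>
    measure_eq_zero_of_map_eval hγ (h hs0)
  have hdiag' : γ (⋃ j ∈ {j | μ j ≪ volume}, {x | x j ∈ s}) = 0 :=
    (measure_biUnion_null_iff (Set.to_countable _)).2 fun j h => hdiag j h
  have hsupp : γ γ.supportᶜ = 0 := Measure.measure_compl_support
  refine measure_mono_null (fun x hx => ?_)
    (measure_union_null (measure_union_null hT0 hdiag') hsupp)
  by_cases hxs : x ∈ γ.support
  · refine Or.inl ?_
    by_contra hcon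
    rw [Set.mem_union, not_or] at hcon
    have hne : ∀ j, μ j ≪ volume → x j ≠ pBarycenter p lam x := by
      intro j h hxj
      refine hcon.2 (Set.mem_biUnion (x := j) h ?_)
      change x j ∈ s
      rw [hxj]
      exact hx
    exact hcon.1 ⟨⟨hxs, hne i hi, fun j => (hj j).imp_left (hne j)⟩, hx⟩
  · exact Or.inr hxs

end AbsolutelyContinuous

/-! ### Existence of optimal two-marginal plans. -/

section OptimalPlans

/-- The integral is the supremum over `n` of the integrals of the truncations `min c n`, each weakly
continuous in the measure. -/
theorem lowerSemicontinuous_lintegral_probabilityMeasure {X : Type*} [TopologicalSpace X]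
    [MeasurableSpace X] [OpensMeasurableSpace X] {c : X → NNReal} (hc : Continuous c) :
    LowerSemicontinuous fun η : ProbabilityMeasure X => ∫⁻ x, c x ∂(η : Measure X) := by
  have htrunc : ∀ η : ProbabilityMeasure X, ∫⁻ x, c x ∂(η : Measure X) =
      ⨆ n : ℕ, ∫⁻ x, (min (c x) (n : NNReal) : NNReal) ∂(η : Measure X) := by
    intro η
    rw [← lintegral_iSup]
    · congr 1 with x
      refine le_antisymm ?_ (iSup_le fun n => by exact_mod_cast min_le_left _ _)
      obtain ⟨n, hn⟩ := exists_nat_ge (c x)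
      refine le_iSup_of_le n ?_
      rw [min_eq_left hn]
    · exact fun n => (hc.min continuous_const).measurable.coe_nnreal_ennreal
    · intro m n hmn x
      have : (m : NNReal) ≤ n := by exact_mod_cast hmn
      exact ENNReal.coe_le_coe.2 (min_le_min_left _ this)
  simp_rw [htrunc]
  refine lowerSemicontinuous_iSup fun n => Continuous.lowerSemicontinuous ?_
  let f : BoundedContinuousFunction X NNReal :=
    BoundedContinuousFunction.mkOfBound ⟨fun x => min (c x) n, hc.min continuous_const⟩ n
      fun x y => by
        rw [NNReal.dist_eq, abs_sub_le_iff]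
        have h1 : ∀ z, ((min (c z) (n : NNReal) : NNReal) : ℝ) ≤ n := fun z => by
          exact_mod_cast min_le_right (c z) (n : NNReal)
        constructor
        · linarith [h1 x, NNReal.coe_nonneg (min (c y) (n : NNReal)),
            show ((⟨fun x => min (c x) n, hc.min continuous_const⟩ : C(X, NNReal)) x : ℝ) =
              (min (c x) (n : NNReal) : NNReal) from rfl,
            show ((⟨fun x => min (c x) n, hc.min continuous_const⟩ : C(X, NNReal)) y : ℝ) =
              (min (c y) (n : NNReal) : NNReal) from rfl]
        · linarith [h1 y, NNReal.coe_nonneg (min (c x) (n : NNReal)),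
            show ((⟨fun x => min (c x) n, hc.min continuous_const⟩ : C(X, NNReal)) x : ℝ) =
              (min (c x) (n : NNReal) : NNReal) from rfl,
            show ((⟨fun x => min (c x) n, hc.min continuous_const⟩ : C(X, NNReal)) y : ℝ) =
              (min (c y) (n : NNReal) : NNReal) from rfl]
  exact ProbabilityMeasure.continuous_lintegral_boundedContinuousFunction f

theorem prod_mem_plans {E : Type*} [MeasurableSpace E] (μ ρ : Measure E)
    [IsProbabilityMeasure μ] [IsProbabilityMeasure ρ] : μ.prod ρ ∈ plans μ ρ :=
  ⟨inferInstance, by simp, by simp⟩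

/-- Existence of optimal transport plans for continuous nonnegative costs. -/
theorem exists_optimal_plan {E : Type*} [MetricSpace E] [CompleteSpace E]
    [SecondCountableTopology E] [MeasurableSpace E] [BorelSpace E] (μ ρ : Measure E)
    [IsProbabilityMeasure μ] [IsProbabilityMeasure ρ] {c : E × E → NNReal} (hc : Continuous c) :
    ∃ η ∈ plans μ ρ, ∀ η' ∈ plans μ ρ, ∫⁻ z, c z ∂η ≤ ∫⁻ z, c z ∂η' := by
  set S : Set (ProbabilityMeasure (E × E)) := {η | (η : Measure (E × E)) ∈ plans μ ρ} with hS
  have htight : IsTightMeasureSet {((η : ProbabilityMeasure (E × E)) : Measure (E × E)) | η ∈ S} := by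
    refine IsTightMeasureSet.prodMk ((isTightMeasureSet_singleton (μ := μ)).subset ?_)
      ((isTightMeasureSet_singleton (μ := ρ)).subset ?_)
    · rintro _ ⟨_, ⟨η, hη, rfl⟩, rfl⟩
      exact hη.2.1
    · rintro _ ⟨_, ⟨η, hη, rfl⟩, rfl⟩
      exact hη.2.2
  have hclosed : IsClosed S := by
    let μ' : ProbabilityMeasure E := ⟨μ, inferInstance⟩
    let ρ' : ProbabilityMeasure E := ⟨ρ, inferInstance⟩
    have : S = {η | η.map measurable_fst.aemeasurable = μ'} ∩
        {η | η.map measurable_snd.aemeasurable = ρ'} := by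
      ext η
      refine ⟨fun h => ⟨Subtype.ext h.2.1, Subtype.ext h.2.2⟩, fun h => ⟨η.2, ?_, ?_⟩⟩
      · exact congrArg Subtype.val h.1
      · exact congrArg Subtype.val h.2
    rw [this]
    exact (isClosed_eq (ProbabilityMeasure.continuous_map continuous_fst) continuous_const).inter
      (isClosed_eq (ProbabilityMeasure.continuous_map continuous_snd) continuous_const)
  -- Prokhorov: fixed marginals make the plans tight.
  have hcomp : IsCompact S := by
    have := isCompact_closure_of_isTightMeasureSet htight
    rwa [hclosed.closure_eq] at this
  obtain ⟨η, hη, hmin⟩ := ((lowerSemicontinuous_lintegral_probabilityMeasure hc).lowerSemicontinuousOn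
    S).exists_isMinOn ⟨⟨μ.prod ρ, inferInstance⟩, prod_mem_plans μ ρ⟩ hcomp
  exact ⟨η, hη, fun η' hη' => hmin (show (⟨η', hη'.1⟩ : ProbabilityMeasure (E × E)) ∈ S from hη')⟩

end OptimalPlans

/-! ### Gluing plans along a common marginal. -/

section Gluing

open ProbabilityTheory

theorem measurable_measure_pi {α : Type*} {ι : Type*} [Fintype ι] {X : ι → Type*}
    [MeasurableSpace α] [∀ i, MeasurableSpace (X i)] (κ : ∀ i, Kernel α (X i))
    [∀ i, IsMarkovKernel (κ i)] : Measurable fun a => Measure.pi fun i => κ i a := by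
  refine Measurable.measure_of_isPiSystem_of_isProbabilityMeasure generateFrom_pi.symm
    isPiSystem_pi ?_
  rintro _ ⟨s, hs, rfl⟩
  simp_rw [Measure.pi_pi]
  exact Finset.measurable_prod _ fun i _ => (κ i).measurable_coe (hs i (Set.mem_univ i))

/-- Gluing of plans along a common second marginal. -/
theorem exists_gluing {E : Type*} [MeasurableSpace E] [StandardBorelSpace E] [Nonempty E] {N : ℕ}
    {μ : Fin N → Measure E} {ν : Measure E} [IsProbabilityMeasure ν] {η : Fin N → Measure (E × E)}
    (hη : ∀ i, η i ∈ plans (μ i) ν) :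
    ∃ γ : Measure (E × (Fin N → E)), IsProbabilityMeasure γ ∧
      ∀ i, γ.map (fun q => (q.2 i, q.1)) = η i := by
  have := fun i => (hη i).1
  have hswap : ∀ i, IsProbabilityMeasure ((η i).map Prod.swap) := fun i =>
    Measure.isProbabilityMeasure_map measurable_swap.aemeasurable
  let κ : Fin N → Kernel E E := fun i => ((η i).map Prod.swap).condKernel
  have hfst : ∀ i, ((η i).map Prod.swap).fst = ν := fun i => by
    rw [Measure.fst_map_swap]
    exact (hη i).2.2
  have hκ : ∀ i, ν ⊗ₘ κ i = (η i).map Prod.swap := fun i => by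
    conv_lhs => rw [← hfst i]
    exact Measure.disintegrate _ _
  -- Given `z`, the components are taken independent, each with its own conditional law.
  let K : Kernel E (Fin N → E) := ⟨fun z => Measure.pi fun i => κ i z, measurable_measure_pi κ⟩
  have hK : IsMarkovKernel K :=
    ⟨fun z => (inferInstance : IsProbabilityMeasure (Measure.pi fun i => κ i z))⟩
  have hKi : ∀ i, K.map (fun x => x i) = κ i := fun i => by
    ext z : 1
    rw [Kernel.map_apply _ (measurable_pi_apply i)]
    change (Measure.pi fun i => κ i z).map (Function.eval i) = κ i z
    rw [Measure.pi_map_eval]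
    simp
  refine ⟨ν ⊗ₘ K, inferInstance, fun i => ?_⟩
  have h1 := Measure.compProd_map (μ := ν) (κ := K) (measurable_pi_apply i)
  rw [hKi i, hκ i] at h1
  have h2 := congrArg (Measure.map Prod.swap) h1
  rw [Measure.map_map measurable_swap measurable_swap, Prod.swap_swap_eq, Measure.map_id,
    Measure.map_map measurable_swap (by fun_prop)] at h2
  exact h2.symm

end Gluing

/-! ### Optimality implies monotonicity of the support. -/

section Monotonicity

/-- The support of an optimal multi-marginal plan is `c`-monotone. -/
theorem isCMonotone_support_of_optimal {E : Type*} [TopologicalSpace E]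
    [SecondCountableTopology E] [MeasurableSpace E] [BorelSpace E] {N : ℕ} {μ : Fin N → Measure E}
    {c : (Fin N → E) → ℝ} (hc : Continuous c) (hc0 : ∀ x, 0 ≤ c x) {γ : Measure (Fin N → E)}
    (hγ : γ ∈ multiPlans μ) (hfin : ∫⁻ x, ENNReal.ofReal (c x) ∂γ ≠ ∞)
    (hopt : ∀ γ' ∈ multiPlans μ,
      ∫⁻ x, ENNReal.ofReal (c x) ∂γ ≤ ∫⁻ x, ENNReal.ofReal (c x) ∂γ') :
    IsCMonotone c γ.support := by
  intro x hx σ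
  by_contra! hlt
  have := hγ.1
  set T : Fin 2 → (Fin N → E) × (Fin N → E) → Fin N → E :=
    fun k q i => ![q.1, q.2] (σ i k) i with hT
  have hTcont : ∀ k, Continuous (T k) := fun k => continuous_pi fun i => by
    have : ∀ l : Fin 2, Continuous fun q : (Fin N → E) × (Fin N → E) => ![q.1, q.2] l i := by
      rw [Fin.forall_fin_two]
      exact ⟨(continuous_apply i).comp continuous_fst, (continuous_apply i).comp continuous_snd⟩
    exact this _
  have hW : IsOpen {q : (Fin N → E) × (Fin N → E) | c (T 0 q) + c (T 1 q) < c q.1 + c q.2} :=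
    isOpen_lt ((hc.comp (hTcont 0)).add (hc.comp (hTcont 1)))
      ((hc.comp continuous_fst).add (hc.comp continuous_snd))
  obtain ⟨U, V, hU, hV, hxU, hyV, hUV⟩ := isOpen_prod_iff.1 hW (x 0) (x 1) (by
    have hxx : ∀ k i, ![x 0, x 1] (σ i k) i = x (σ i k) i := fun k i => by
      generalize σ i k = l
      fin_cases l <;> rfl
    change c (fun i => ![x 0, x 1] (σ i 0) i) + c (fun i => ![x 0, x 1] (σ i 1) i) < _
    simpa only [hxx] using hlt)
  have hUpos : γ U ≠ 0 := ((Measure.mem_support_iff_forall _).1 (hx 0) U (hU.mem_nhds hxU)).ne'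
  have hVpos : γ V ≠ 0 := ((Measure.mem_support_iff_forall _).1 (hx 1) V (hV.mem_nhds hyV)).ne'
  -- Pairs near the offending points, drawn independently; exchanging components strictly lowers the
  -- cost of each.
  set π := (γ.restrict U).prod (γ.restrict V) with hπ
  have hπ0 : π ≠ 0 := by
    intro h
    have : π Set.univ = 0 := by rw [h]; rfl
    rw [← Set.univ_prod_univ, Measure.prod_prod] at this
    simp [hUpos, hVpos] at this
  have hπW : ∀ᵐ q ∂π, c (T 0 q) + c (T 1 q) < c q.1 + c q.2 := by
    rw [hπ, Measure.prod_restrict]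
    filter_upwards [ae_restrict_mem (hU.measurableSet.prod hV.measurableSet)] with q hq
    exact hUV hq
  -- Each marginal of `π` is at most `γ`, so half of their sum can be removed from `γ`, even if `U`
  -- and `V` overlap.
  set θ : ℝ≥0∞ := 2⁻¹ with hθ
  set Q := θ • (π.map Prod.fst + π.map Prod.snd) with hQ
  set A := θ • (π.map (T 0) + π.map (T 1)) with hA
  have hQγ : Q ≤ γ := by
    have h1 : π.map Prod.fst ≤ γ := by
      rw [hπ, Measure.map_fst_prod]
      calc _ ≤ (1 : ℝ≥0∞) • γ.restrict U := by
            gcongr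
            rw [Measure.restrict_apply_univ]
            exact prob_le_one
        _ ≤ γ := by rw [one_smul]; exact Measure.restrict_le_self
    have h2 : π.map Prod.snd ≤ γ := by
      rw [hπ, Measure.map_snd_prod]
      calc _ ≤ (1 : ℝ≥0∞) • γ.restrict V := by
            gcongr
            rw [Measure.restrict_apply_univ]
            exact prob_le_one
        _ ≤ γ := by rw [one_smul]; exact Measure.restrict_le_self
    calc Q ≤ θ • (γ + γ) := by rw [hQ]; gcongr
      _ = γ := by rw [smul_add, ← add_smul, hθ, ENNReal.inv_two_add_inv_two, one_smul]
  have hQfin : IsFiniteMeasure Q := isFiniteMeasure_of_le γ hQγ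
  have hdec : γ - Q + Q = γ := Measure.sub_add_cancel_of_le hQγ
  have hmarg : ∀ i, A.map (fun x => x i) = Q.map (fun x => x i) := by
    intro i
    have hm := measurable_pi_apply (X := fun _ : Fin N => E) i
    rw [hA, hQ, Measure.map_smul, Measure.map_smul, Measure.map_add _ _ hm,
      Measure.map_add _ _ hm, Measure.map_map hm (hTcont 0).measurable,
      Measure.map_map hm (hTcont 1).measurable, Measure.map_map hm measurable_fst,
      Measure.map_map hm measurable_snd]
    congr 1
    have hσ : (σ i 0 = 0 ∧ σ i 1 = 1) ∨ (σ i 0 = 1 ∧ σ i 1 = 0) := by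
      have h01 : σ i 0 ≠ σ i 1 := (σ i).injective.ne (by decide)
      generalize σ i 0 = a at *
      generalize σ i 1 = b at *
      revert a b
      decide
    rcases hσ with ⟨h0, h1⟩ | ⟨h0, h1⟩
    · congr 2 <;> funext q <;> simp [hT, h0, h1]
    · rw [add_comm]
      congr 2 <;> funext q <;> simp [hT, h0, h1]
  have hmass : A Set.univ = Q Set.univ := by
    simp only [hA, hQ, Measure.smul_apply, Measure.add_apply]
    rw [Measure.map_apply (hTcont 0).measurable .univ, Measure.map_apply (hTcont 1).measurable .univ,
      Measure.map_apply measurable_fst .univ, Measure.map_apply measurable_snd .univ]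
    simp
  -- The competitor replaces `Q` by its exchanged version `A`, which has the same one-component
  -- marginals.
  set γ' := γ - Q + A with hγ'
  have hmem : γ' ∈ multiPlans μ := by
    refine ⟨⟨?_⟩, fun i => ?_⟩
    · rw [hγ', Measure.add_apply, hmass, ← Measure.add_apply, hdec]
      exact measure_univ
    · have hm := measurable_pi_apply (X := fun _ : Fin N => E) i
      rw [hγ', Measure.map_add _ _ hm, hmarg, ← Measure.map_add _ _ hm, hdec]
      exact hγ.2 i
  set G : (Fin N → E) → ℝ≥0∞ := fun x => ENNReal.ofReal (c x) with hG
  have hGm : Measurable G := hc.measurable.ennreal_ofReal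
  have hTm : ∀ k, Measurable (T k) := fun k => (hTcont k).measurable
  have hIQ : ∫⁻ x, G x ∂Q = θ * ∫⁻ q, G q.1 + G q.2 ∂π := by
    rw [hQ, lintegral_smul_measure, lintegral_add_measure, lintegral_map hGm measurable_fst,
      lintegral_map hGm measurable_snd,
      lintegral_add_left (f := fun q : (Fin N → E) × (Fin N → E) => G q.1) (hGm.comp measurable_fst), smul_eq_mul]
  have hIA : ∫⁻ x, G x ∂A = θ * ∫⁻ q, G (T 0 q) + G (T 1 q) ∂π := by
    rw [hA, lintegral_smul_measure, lintegral_add_measure, lintegral_map hGm (hTm 0),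
      lintegral_map hGm (hTm 1),
      lintegral_add_left (f := fun q => G (T 0 q)) (hGm.comp (hTm 0)), smul_eq_mul]
  have hIQfin : ∫⁻ x, G x ∂Q ≠ ∞ := ne_top_of_le_ne_top hfin (lintegral_mono' hQγ le_rfl)
  have hθ0 : θ ≠ 0 := by simp [hθ]
  have hθt : θ ≠ ∞ := by simp [hθ]
  have hae : ∀ᵐ q ∂π, G (T 0 q) + G (T 1 q) < G q.1 + G q.2 := by
    filter_upwards [hπW] with q hq
    simp only [hG]
    rw [← ENNReal.ofReal_add (hc0 _) (hc0 _), ← ENNReal.ofReal_add (hc0 _) (hc0 _)]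
    exact (ENNReal.ofReal_lt_ofReal_iff_of_nonneg (add_nonneg (hc0 _) (hc0 _))).2 hq
  have hπfin : ∫⁻ q, G q.1 + G q.2 ∂π ≠ ∞ := by
    intro h
    rw [hIQ, h, ENNReal.mul_top hθ0] at hIQfin
    exact hIQfin rfl
  have hstrict : ∫⁻ q, G (T 0 q) + G (T 1 q) ∂π < ∫⁻ q, G q.1 + G q.2 ∂π :=
    lintegral_strict_mono hπ0
      ((hGm.comp measurable_fst).add (hGm.comp measurable_snd)).aemeasurable
      (ne_top_of_le_ne_top hπfin (lintegral_mono_ae (hae.mono fun _ h => h.le))) hae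
  have hAQ : ∫⁻ x, G x ∂A < ∫⁻ x, G x ∂Q := by
    rw [hIA, hIQ]
    exact ENNReal.mul_lt_mul_right hθ0 hθt hstrict
  have hrest : ∫⁻ x, G x ∂(γ - Q) ≠ ∞ :=
    ne_top_of_le_ne_top hfin (lintegral_mono' Measure.sub_le le_rfl)
  have hfinal := hopt γ' hmem
  rw [hγ', lintegral_add_measure] at hfinal
  conv_lhs at hfinal => rw [← hdec, lintegral_add_measure]
  exact absurd hfinal (not_le.2 (ENNReal.add_lt_add_left hrest hAQ))

end Monotonicity

/-! ### Wasserstein barycenters and the multi-marginal problem. -/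

section WassersteinBarycenter

variable {d N : ℕ} {p : ℝ} {lam : Fin N → ℝ}

theorem ofReal_weightedPowSum (hp : 1 < p) (hlam : ∀ i, 0 < lam i)
    (x : Fin N → EuclideanSpace ℝ (Fin d)) (z : EuclideanSpace ℝ (Fin d)) :
    ENNReal.ofReal (weightedPowSum p lam x z) =
      ∑ i, ENNReal.ofReal (lam i) * ‖x i - z‖ₑ ^ p := by
  unfold weightedPowSum
  rw [ENNReal.ofReal_sum_of_nonneg fun i _ =>
    mul_nonneg (hlam i).le (Real.rpow_nonneg (norm_nonneg _) _)]
  refine Finset.sum_congr rfl fun i _ => ?_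
  rw [ENNReal.ofReal_mul (hlam i).le,
    ← ENNReal.ofReal_rpow_of_nonneg (norm_nonneg _) (by linarith), ofReal_norm]

theorem wassersteinDist_rpow_le (hp : 1 < p) {μ ρ : Measure (EuclideanSpace ℝ (Fin d))}
    {η : Measure (EuclideanSpace ℝ (Fin d) × EuclideanSpace ℝ (Fin d))} (hη : η ∈ plans μ ρ) :
    wassersteinDist p μ ρ ^ p ≤ ∫⁻ z, ‖z.1 - z.2‖ₑ ^ p ∂η := by
  have hp0 : 0 < p := by linarith
  have h : wassersteinDist p μ ρ ≤ (∫⁻ z, ‖z.1 - z.2‖ₑ ^ p ∂η) ^ (1 / p) := iInf₂_le η hη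
  have := ENNReal.rpow_le_rpow h hp0.le
  rwa [one_div, ENNReal.rpow_inv_rpow hp0.ne'] at this

theorem exists_plan_lintegral_le_wassersteinDist_rpow (hp : 1 < p)
    (μ ρ : Measure (EuclideanSpace ℝ (Fin d))) [IsProbabilityMeasure μ] [IsProbabilityMeasure ρ] :
    ∃ η ∈ plans μ ρ, ∫⁻ z, ‖z.1 - z.2‖ₑ ^ p ∂η ≤ wassersteinDist p μ ρ ^ p := by
  have hp0 : 0 < p := by linarith
  obtain ⟨η, hη, hmin⟩ := exists_optimal_plan μ ρ
    (c := fun z : EuclideanSpace ℝ (Fin d) × EuclideanSpace ℝ (Fin d) => ‖z.1 - z.2‖₊ ^ p)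
    ((NNReal.continuous_rpow_const hp0.le).comp (continuous_fst.sub continuous_snd).nnnorm)
  have hcoe : ∀ z : EuclideanSpace ℝ (Fin d) × EuclideanSpace ℝ (Fin d),
      ((‖z.1 - z.2‖₊ ^ p : NNReal) : ℝ≥0∞) = ‖z.1 - z.2‖ₑ ^ p := fun z =>
    ENNReal.coe_rpow_of_nonneg _ hp0.le
  simp_rw [hcoe] at hmin
  refine ⟨η, hη, ?_⟩
  have h : (∫⁻ z, ‖z.1 - z.2‖ₑ ^ p ∂η) ^ (1 / p) ≤ wassersteinDist p μ ρ :=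
    le_iInf₂ fun η' hη' => ENNReal.rpow_le_rpow (hmin η' hη') (by positivity)
  have := ENNReal.rpow_le_rpow h hp0.le
  rwa [one_div, ENNReal.rpow_inv_rpow hp0.ne'] at this

theorem enorm_add_rpow_le (hp : 1 < p) {E : Type*} [NormedAddCommGroup E] (a b : E) :
    ‖a + b‖ₑ ^ p ≤ 2 ^ (p - 1) * (‖a‖ₑ ^ p + ‖b‖ₑ ^ p) :=
  (ENNReal.rpow_le_rpow (enorm_add_le a b) (by linarith)).trans
    (ENNReal.rpow_add_le_mul_rpow_add_rpow _ _ hp.le)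

theorem lintegral_enorm_add_rpow_lt_top (hp : 1 < p) {E α : Type*} [NormedAddCommGroup E]
    [MeasurableSpace E] [BorelSpace E] [MeasurableSpace α] {π : Measure α} {f g : α → E}
    (hf : Measurable f) (hf' : ∫⁻ a, ‖f a‖ₑ ^ p ∂π < ∞) (hg' : ∫⁻ a, ‖g a‖ₑ ^ p ∂π < ∞) :
    ∫⁻ a, ‖f a + g a‖ₑ ^ p ∂π < ∞ := by
  refine (lintegral_mono fun a => enorm_add_rpow_le hp (f a) (g a)).trans_lt ?_
  have h2 : (2 : ℝ≥0∞) ^ (p - 1) ≠ ∞ :=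
    ENNReal.rpow_ne_top_of_nonneg (by linarith) (by simp)
  rw [lintegral_const_mul' _ _ h2, lintegral_add_left (hf.enorm.pow_const p)]
  exact ENNReal.mul_lt_top h2.lt_top (ENNReal.add_lt_top.2 ⟨hf', hg'⟩)

theorem wassersteinDist_rpow_lt_top (hp : 1 < p) {μ ρ : Measure (EuclideanSpace ℝ (Fin d))}
    (hμ : μ ∈ probMeasuresFiniteMoment d p) (hρ : ρ ∈ probMeasuresFiniteMoment d p) :
    wassersteinDist p μ ρ ^ p < ∞ := by
  have := hμ.1
  have := hρ.1
  refine (wassersteinDist_rpow_le hp (prod_mem_plans μ ρ)).trans_lt ?_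
  simp_rw [sub_eq_add_neg]
  refine lintegral_enorm_add_rpow_lt_top hp measurable_fst ?_ ?_
  · have h := lintegral_map (μ := μ.prod ρ) (g := Prod.fst)
      (f := fun x : EuclideanSpace ℝ (Fin d) => ‖x‖ₑ ^ p) (by fun_prop) measurable_fst
    rw [(prod_mem_plans μ ρ).2.1] at h
    exact h ▸ hμ.2
  · simp_rw [enorm_neg]
    have h := lintegral_map (μ := μ.prod ρ) (g := Prod.snd)
      (f := fun x : EuclideanSpace ℝ (Fin d) => ‖x‖ₑ ^ p) (by fun_prop) measurable_snd
    rw [(prod_mem_plans μ ρ).2.2] at h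
    exact h ▸ hρ.2

theorem lintegral_ofReal_pCost (hp : 1 < p) (hlam : ∀ i, 0 < lam i) (hsum : ∑ i, lam i = 1)
    (γ : Measure (Fin N → EuclideanSpace ℝ (Fin d))) :
    ∫⁻ x, ENNReal.ofReal (pCost p lam x) ∂γ =
      ∑ i, ENNReal.ofReal (lam i) * ∫⁻ x, ‖x i - pBarycenter p lam x‖ₑ ^ p ∂γ := by
  have hm := (continuous_pBarycenter (d := d) hp hlam hsum).measurable
  simp_rw [pCost, ofReal_weightedPowSum hp hlam]
  rw [lintegral_finsetSum]
  · exact Finset.sum_congr rfl fun i _ => lintegral_const_mul' _ _ ENNReal.ofReal_ne_top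
  · exact fun i _ => (((measurable_pi_apply i).sub hm).enorm.pow_const p).const_mul _

theorem nonempty_of_sum_eq_one (hsum : ∑ i, lam i = 1) : Nonempty (Fin N) := by
  by_contra h
  rw [not_nonempty_iff] at h
  simp at hsum

/-- The barycenter functional is bounded above by the multi-marginal cost of the push-forward. -/
theorem sum_wassersteinDist_map_le_lintegral_pCost (hp : 1 < p) (hlam : ∀ i, 0 < lam i)
    (hsum : ∑ i, lam i = 1) {μ : Fin N → Measure (EuclideanSpace ℝ (Fin d))}
    {γ : Measure (Fin N → EuclideanSpace ℝ (Fin d))} (hγ : γ ∈ multiPlans μ) :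
    ∑ i, ENNReal.ofReal (lam i) * wassersteinDist p (μ i) (γ.map (pBarycenter p lam)) ^ p ≤
      ∫⁻ x, ENNReal.ofReal (pCost p lam x) ∂γ := by
  have := hγ.1
  have hm := (continuous_pBarycenter (d := d) hp hlam hsum).measurable
  rw [lintegral_ofReal_pCost hp hlam hsum]
  refine Finset.sum_le_sum fun i _ => mul_le_mul_right ?_ _
  have hg : Measurable fun x : Fin N → EuclideanSpace ℝ (Fin d) => (x i, pBarycenter p lam x) :=
    (measurable_pi_apply i).prodMk hm
  refine (wassersteinDist_rpow_le hp (η := γ.map fun x => (x i, pBarycenter p lam x))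
    ⟨Measure.isProbabilityMeasure_map hg.aemeasurable, ?_, ?_⟩).trans_eq ?_
  · rw [Measure.map_map measurable_fst hg]
    exact hγ.2 i
  · rw [Measure.map_map measurable_snd hg]
    rfl
  · rw [lintegral_map (by fun_prop) hg]

theorem map_pBarycenter_mem_probMeasuresFiniteMoment (hp : 1 < p) (hlam : ∀ i, 0 < lam i)
    (hsum : ∑ i, lam i = 1) {μ : Fin N → Measure (EuclideanSpace ℝ (Fin d))}
    (hμ : ∀ i, μ i ∈ probMeasuresFiniteMoment d p)
    {γ : Measure (Fin N → EuclideanSpace ℝ (Fin d))} (hγ : γ ∈ multiPlans μ)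
    (hfin : ∫⁻ x, ENNReal.ofReal (pCost p lam x) ∂γ < ∞) :
    γ.map (pBarycenter p lam) ∈ probMeasuresFiniteMoment d p := by
  have := hγ.1
  have hm := (continuous_pBarycenter (d := d) hp hlam hsum).measurable
  obtain ⟨i⟩ := nonempty_of_sum_eq_one hsum
  refine ⟨Measure.isProbabilityMeasure_map hm.aemeasurable, ?_⟩
  rw [lintegral_map (by fun_prop) hm]
  have hsplit : ∀ x : Fin N → EuclideanSpace ℝ (Fin d),
      pBarycenter p lam x = x i + -(x i - pBarycenter p lam x) := fun x => by abel
  have hi := measurable_pi_apply (X := fun _ : Fin N => EuclideanSpace ℝ (Fin d)) i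
  have h := lintegral_enorm_add_rpow_lt_top (π := γ) hp hi
    (g := fun x => -(x i - pBarycenter p lam x)) ?_ ?_
  · simp_rw [← hsplit] at h
    exact h
  · have h := lintegral_map (μ := γ) (g := fun x => x i)
      (f := fun x : EuclideanSpace ℝ (Fin d) => ‖x‖ₑ ^ p) (by fun_prop) hi
    rw [hγ.2 i] at h
    exact h ▸ (hμ i).2
  · simp_rw [enorm_neg]
    rw [lintegral_ofReal_pCost hp hlam hsum, ENNReal.sum_lt_top] at hfin
    have := hfin i (Finset.mem_univ i)
    exact ENNReal.lt_top_of_mul_ne_top_right this.ne (by simpa using hlam i)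

theorem IsWassersteinBarycenter.le_lintegral_pCost (hp : 1 < p) (hlam : ∀ i, 0 < lam i)
    (hsum : ∑ i, lam i = 1) {μ : Fin N → Measure (EuclideanSpace ℝ (Fin d))}
    (hμ : ∀ i, μ i ∈ probMeasuresFiniteMoment d p) {ν : Measure (EuclideanSpace ℝ (Fin d))}
    (hν : IsWassersteinBarycenter p lam μ ν)
    {γ : Measure (Fin N → EuclideanSpace ℝ (Fin d))} (hγ : γ ∈ multiPlans μ) :
    ∑ i, ENNReal.ofReal (lam i) * wassersteinDist p (μ i) ν ^ p ≤
      ∫⁻ x, ENNReal.ofReal (pCost p lam x) ∂γ := by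
  -- Finite cost is what guarantees that the image measure has a finite moment and so is an
  -- admissible competitor.
  rcases eq_or_ne (∫⁻ x, ENNReal.ofReal (pCost p lam x) ∂γ) ∞ with h | h
  · rw [h]; exact le_top
  · exact (hν.2 (map_pBarycenter_mem_probMeasuresFiniteMoment hp hlam hsum hμ hγ h.lt_top)).trans
      (sum_wassersteinDist_map_le_lintegral_pCost hp hlam hsum hγ)

/-- Every Wasserstein barycenter is the image, under the barycenter map of points, of an optimal
multi-marginal plan. -/
theorem IsWassersteinBarycenter.exists_optimal_multiPlan (hp : 1 < p) (hlam : ∀ i, 0 < lam i)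
    (hsum : ∑ i, lam i = 1) {μ : Fin N → Measure (EuclideanSpace ℝ (Fin d))}
    (hμ : ∀ i, μ i ∈ probMeasuresFiniteMoment d p) {ν : Measure (EuclideanSpace ℝ (Fin d))}
    (hν : IsWassersteinBarycenter p lam μ ν) :
    ∃ γ ∈ multiPlans μ, ∫⁻ x, ENNReal.ofReal (pCost p lam x) ∂γ ≠ ∞ ∧
      (∀ γ' ∈ multiPlans μ, ∫⁻ x, ENNReal.ofReal (pCost p lam x) ∂γ ≤
        ∫⁻ x, ENNReal.ofReal (pCost p lam x) ∂γ') ∧ ν = γ.map (pBarycenter p lam) := by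
  have := hν.1.1
  have := fun i => (hμ i).1
  obtain ⟨i₀⟩ := nonempty_of_sum_eq_one hsum
  have hm := (continuous_pBarycenter (d := d) hp hlam hsum).measurable
  choose η hη hηle using fun i => exists_plan_lintegral_le_wassersteinDist_rpow hp (μ i) ν
  obtain ⟨Γ, hΓ, hΓη⟩ := exists_gluing hη
  have hpair : ∀ i, Measurable fun q : EuclideanSpace ℝ (Fin d) × (Fin N → EuclideanSpace ℝ (Fin d)) =>
      (q.2 i, q.1) := fun i => ((measurable_pi_apply i).comp measurable_snd).prodMk measurable_fst
  have hγ : Γ.map Prod.snd ∈ multiPlans μ := by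
    refine ⟨Measure.isProbabilityMeasure_map measurable_snd.aemeasurable, fun i => ?_⟩
    rw [Measure.map_map (measurable_pi_apply i) measurable_snd, ← (hη i).2.1, ← hΓη i,
      Measure.map_map measurable_fst (hpair i)]
    rfl
  have hΓν : Γ.map Prod.fst = ν := by
    rw [← (hη i₀).2.2, ← hΓη i₀, Measure.map_map measurable_snd (hpair i₀)]
    rfl
  have hGm : Measurable fun x : Fin N → EuclideanSpace ℝ (Fin d) =>
      ENNReal.ofReal (pCost p lam x) := (continuous_pCost hp hlam hsum).measurable.ennreal_ofReal
  have hFm : Measurable fun q : EuclideanSpace ℝ (Fin d) × (Fin N → EuclideanSpace ℝ (Fin d)) =>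
      ENNReal.ofReal (weightedPowSum p lam q.2 q.1) :=
    ((continuous_weightedPowSum hp).measurable.comp measurable_swap).ennreal_ofReal
  set A := ∑ i, ENNReal.ofReal (lam i) * wassersteinDist p (μ i) ν ^ p with hA
  have hAfin : A ≠ ∞ := ENNReal.sum_ne_top.2 fun i _ =>
    ENNReal.mul_ne_top ENNReal.ofReal_ne_top (wassersteinDist_rpow_lt_top hp (hμ i) hν.1).ne
  have hF : ∫⁻ q, ENNReal.ofReal (weightedPowSum p lam q.2 q.1) ∂Γ ≤ A := by
    simp_rw [ofReal_weightedPowSum hp hlam]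
    rw [lintegral_finsetSum]
    · refine Finset.sum_le_sum fun i _ => ?_
      rw [lintegral_const_mul' _ _ ENNReal.ofReal_ne_top]
      refine mul_le_mul_right ((hηle i).trans' (le_of_eq ?_)) _
      rw [← hΓη i, lintegral_map (by fun_prop) (hpair i)]
    · exact fun i _ => by fun_prop
  have hG : ∫⁻ x, ENNReal.ofReal (pCost p lam x) ∂(Γ.map Prod.snd) =
      ∫⁻ q, ENNReal.ofReal (pCost p lam q.2) ∂Γ := lintegral_map hGm measurable_snd
  have hle : ∀ q : EuclideanSpace ℝ (Fin d) × (Fin N → EuclideanSpace ℝ (Fin d)),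
      ENNReal.ofReal (pCost p lam q.2) ≤ ENNReal.ofReal (weightedPowSum p lam q.2 q.1) := fun q =>
    ENNReal.ofReal_le_ofReal (pCost_le hp hlam hsum _ _)
  have hAle : A ≤ ∫⁻ q, ENNReal.ofReal (pCost p lam q.2) ∂Γ :=
    hG ▸ hν.le_lintegral_pCost hp hlam hsum hμ hγ
  have hGle : ∫⁻ q, ENNReal.ofReal (pCost p lam q.2) ∂Γ ≤ A := (lintegral_mono hle).trans hF
  have hfin : ∫⁻ q, ENNReal.ofReal (pCost p lam q.2) ∂Γ ≠ ∞ := ne_top_of_le_ne_top hAfin hGle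
  -- Equal finite integrals force the common-marginal point to be a minimizer almost surely; by
  -- uniqueness it is the barycenter.
  have hae := ae_eq_of_ae_le_of_lintegral_le (Eventually.of_forall hle) hfin hFm.aemeasurable
    (hF.trans hAle)
  refine ⟨Γ.map Prod.snd, hγ, hG ▸ hfin, fun γ' hγ' => ?_, ?_⟩
  · rw [hG]
    exact hGle.trans (hν.le_lintegral_pCost hp hlam hsum hμ hγ')
  · rw [Measure.map_map hm measurable_snd, ← hΓν]
    refine Measure.map_congr (hae.mono fun q hq => ?_)
    refine eq_pBarycenter_of_le hp hlam hsum ?_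
    exact (ENNReal.ofReal_le_ofReal_iff (weightedPowSum_nonneg hlam _ _)).1 hq.ge

end WassersteinBarycenter

theorem theorem1p3 {d N : ℕ} (p : ℝ) (hp : 1 < p)
    (lam : Fin N → ℝ) (hlam : ∀ i, 0 < lam i) (hsum : ∑ i, lam i = 1)
    (μ : Fin N → Measure (EuclideanSpace ℝ (Fin d))) (hμ : ∀ i, IsProbabilityMeasure (μ i))
    (hac : (∀ i, μ i ≪ volume) ∨ (2 ≤ p ∧ ∃ i, μ i ≪ volume)) :
    (Measurable (pBarycenter (d := d) p lam) ∧
      ∀ γ ∈ multiPlans μ, IsCMonotone (pCost p lam) γ.support →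
        γ.map (pBarycenter p lam) ≪ volume) ∧
    ((∀ i, μ i ∈ probMeasuresFiniteMoment d p) →
      ∀ ν, IsWassersteinBarycenter p lam μ ν → ν ≪ volume) := by
  refine ⟨⟨(continuous_pBarycenter hp hlam hsum).measurable, fun γ hγ hmono =>
    map_pBarycenter_absolutelyContinuous hp hlam hsum hac hγ hmono⟩, fun hmom ν hν => ?_⟩
  obtain ⟨γ, hγ, hfin, hopt, rfl⟩ := hν.exists_optimal_multiPlan hp hlam hsum hmom
  exact map_pBarycenter_absolutelyContinuous hp hlam hsum hac hγ
    (isCMonotone_support_of_optimal (continuous_pCost hp hlam hsum)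
      (fun x => weightedPowSum_nonneg hlam _ _) hγ hfin hopt)
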